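/- Let $\mu\in\{0,1,2,\dots\}$, let $n\ge 1$ be an integer with $n>\mu+1$ if $\mu\ge 1$, and let $h=1/n$. Let $\phi_1^{(0)}$ be the indicator function of $\bigcup_{m\in\mathbb Z}[-h/2+m,\,h/2+m)$ on $\mathbb R$, and define recursively $$\phi_1^{(\mu)}(x)=\frac1h\int_{-1/2}^{1/2}\phi_1^{(\mu-1)}(y)\,\phi_1^{(0)}(x-y)\,dy\quad(\mu\ge1),\qquad \phi_\ell^{(\mu)}(x)=\phi_1^{(\mu)}\big(x-(\ell-1)h\big)\quad(\ell=1,\dots,n).$$ Let $H_n$ be the complex linear span of the 1-periodic functions $\phi_1^{(\mu)},\dots,\phi_n^{(\mu)}$. For $s\in\mathbb R$ let $H^s$ be the Sobolev space of 1-periodic distributions $u$ with $$\|u\|_{H^s}=\Big(\sum_{m\in\mathbb Z}(1+m^2)^{s}|u_m|^2\Big)^{1/2}<\infty,\qquad u_m=u\big(e^{-2\pi i m\,\cdot}\big);$$ a 1-periodic locally integrable function $f$ is identified with the distribution $g\mapsto\int_0^1 f g$. Let $\operatorname{sinc}(0)=1$ and $\operatorname{sinc}(x)=\sin(x)/x$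 for $x\ne0$. Theorem. The following hold. 1. (Partition of unity) $\sum_{\ell=1}^n\phi_\ell^{(\mu)}(x)=1$ for all $x\in\mathbb R$. 2. (Evenness) $\phi_1^{(\mu)}(x)=\phi_1^{(\mu)}(-x)$ for all $x\in\mathbb R$ if $\mu\ge1$; for $\mu=0$ this holds for all $x\in\mathbb R$ except possibly at the jump points $x\in\pm h/2+\mathbb Z$. 3. (Fourier coefficients) For $\ell=1,\dots,n$ and $m\in\mathbb Z$, the Fourier coefficient $c_\ell^{(\mu)}(m)=\int_0^1\phi_\ell^{(\mu)}(x)e^{-2\pi i m x}\,dx$ equals $$c_\ell^{(\mu)}(m)=h\,\operatorname{sinc}^{\mu+1}(\pi h m)\,e^{-2\pi i h m(\ell-1)},$$ and $\phi_\ell^{(\mu)}(x)=\sum_{m\in\mathbb Z}c_\ell^{(\mu)}(m)e^{2\pi i m x}$, where the series converges unconditionally in $L_2(0,1)$, and for $\mu\ge1$ also absolutely at every $x\in\mathbb R$. 4. (Sobolev regularity) $\phi_\ell^{(\mu)}\in H^a$ for all $\ell=1,\dots,n$ and all real $a<\mu+1/2$. 5. (Approximation property) For all real $a\le s\le\mu+1$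 with $a<\mu+1/2$ there is a constant $c_1>0$, depending only on $\mu,a,s$, such that for all admissible $n$ and all $u\in H^s$ $$\inf_{u_n\in H_n}\|u-u_n\|_{H^a}\le c_1\,h^{s-a}\|u\|_{H^s}.$$ 6. (Inverse inequality) For all real $a\le s<\mu+1/2$ there is a constant $c_2>0$, depending only on $\mu,a,s$, such that for all admissible $n$ and all $u_n\in H_n$ $$c_2\,h^{s-a}\|u_n\|_{H^s}\le\|u_n\|_{H^a}\le\|u_n\|_{H^s}.$$ -/

import Mathlib

open scoped Real

noncomputable section

namespace PeriodicSpline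

/-! ### Periodic distributions and Sobolev spaces on the one-dimensional torus -/

/-- The space `C^∞(𝕋)` of smooth, 1-periodic, complex-valued functions on the line. -/
def TestFunction : Submodule ℂ (ℝ → ℂ) where
  carrier := {f | ContDiff ℝ ((⊤ : ℕ∞) : WithTop ℕ∞) f ∧ Function.Periodic f 1}
  zero_mem' := ⟨contDiff_const, fun _ => rfl⟩
  add_mem' := fun hf hg => ⟨hf.1.add hg.1, hf.2.add hg.2⟩
  smul_mem' := fun c _ hf => ⟨contDiff_const.smul hf.1, hf.2.smul c⟩

/-- The trigonometric monomial `v_m(x) = e^{2π i m x}`. -/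
def monomialFun (m : ℤ) (x : ℝ) : ℂ :=
  Complex.exp (2 * (π : ℂ) * Complex.I * (m : ℂ) * (x : ℂ))

theorem monomialFun_mem (m : ℤ) : monomialFun m ∈ TestFunction := by
  refine ⟨?_, fun x => ?_⟩
  · unfold monomialFun
    exact (contDiff_const.mul Complex.ofRealCLM.contDiff).cexp
  · unfold monomialFun
    rw [Complex.exp_eq_exp_iff_exists_int]
    exact ⟨m, by push_cast; ring⟩

/-- The monomial `v_m` as a test function. -/
def monomial (m : ℤ) : TestFunction := ⟨monomialFun m, monomialFun_mem m⟩

/-- Periodic distributions: the linear functionals on `C^∞(𝕋)` that are continuous for the topology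
of uniform convergence of all derivatives, i.e. that are bounded by a constant times the maximum of
the sup norms of finitely many derivatives. -/
def Distribution : Submodule ℂ (TestFunction →ₗ[ℂ] ℂ) where
  carrier := {T | ∃ (C : ℝ) (N : ℕ), 0 ≤ C ∧ ∀ (f : TestFunction) (M : ℝ),
    (∀ k ≤ N, ∀ x : ℝ, ‖iteratedDeriv k (f : ℝ → ℂ) x‖ ≤ M) → ‖T f‖ ≤ C * M}
  zero_mem' := ⟨0, 0, le_rfl, fun f M _ => by simp⟩
  add_mem' := by
    rintro S T ⟨C, N, hC, hS⟩ ⟨D, K, hD, hT⟩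
    refine ⟨C + D, max N K, add_nonneg hC hD, fun f M hM => ?_⟩
    have h1 := hS f M fun k hk => hM k (hk.trans (le_max_left _ _))
    have h2 := hT f M fun k hk => hM k (hk.trans (le_max_right _ _))
    calc ‖(S + T) f‖ ≤ ‖S f‖ + ‖T f‖ := norm_add_le _ _
      _ ≤ (C + D) * M := by linarith
  smul_mem' := by
    rintro c T ⟨C, N, hC, hT⟩
    refine ⟨‖c‖ * C, N, by positivity, fun f M hM => ?_⟩
    calc ‖(c • T) f‖ = ‖c‖ * ‖T f‖ := by simp
      _ ≤ ‖c‖ * (C * M) := by gcongr; exact hT f M hM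
      _ = ‖c‖ * C * M := by ring

/-- The Fourier coefficient `T_m = T(v_{-m})` of a periodic distribution. -/
def coeff (T : Distribution) (m : ℤ) : ℂ := T.1 (monomial (-m))

/-- `⟨m⟩ = (1 + |m|²)^{1/2}`. -/
def bracket (m : ℤ) : ℝ := √(1 + (m : ℝ) ^ 2)

/-- The Sobolev norm `(∑ ⟨m⟩^{2s} |T_m|²)^{1/2}`, with the value `∞` if the series diverges. -/
def sobolevNorm (s : ℝ) (T : Distribution) : ENNReal :=
  (∑' m : ℤ, ENNReal.ofReal (bracket m ^ (2 * s) * ‖coeff T m‖ ^ 2)) ^ (1 / 2 : ℝ)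

/-- The periodic Sobolev space `H^s`, for an arbitrary real order `s`. -/
def sobolevSpace (s : ℝ) : Set Distribution := {T | sobolevNorm s T < ⊤}

/-- The 1-periodic, locally integrable functions. -/
def PeriodicIntegrable : Submodule ℂ (ℝ → ℂ) where
  carrier := {f | Function.Periodic f 1 ∧ IntervalIntegrable f MeasureTheory.volume 0 1}
  zero_mem' := ⟨fun _ => rfl, intervalIntegrable_const⟩
  add_mem' := fun hf hg => ⟨hf.1.add hg.1, hf.2.add hg.2⟩
  smul_mem' := fun c _ hf => ⟨hf.1.smul c, hf.2.smul c⟩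

theorem intervalIntegrable_mul (f : PeriodicIntegrable) (g : TestFunction) :
    IntervalIntegrable (fun x => (f : ℝ → ℂ) x * (g : ℝ → ℂ) x) MeasureTheory.volume 0 1 :=
  f.2.2.mul_continuousOn g.2.1.continuous.continuousOn

/-- A periodic integrable function `f`, regarded as the distribution `g ↦ ∫_0^1 f g`. -/
def toDistribution (f : PeriodicIntegrable) : Distribution :=
  ⟨{ toFun := fun g => ∫ x in (0 : ℝ)..1, (f : ℝ → ℂ) x * (g : ℝ → ℂ) x
     map_add' := fun g₁ g₂ => by
       rw [← intervalIntegral.integral_add (intervalIntegrable_mul f g₁)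
         (intervalIntegrable_mul f g₂)]
       simp [mul_add]
     map_smul' := fun c g => by
       rw [RingHom.id_apply, smul_eq_mul, ← intervalIntegral.integral_const_mul]
       simp [mul_left_comm] }, by
    refine ⟨∫ x in (0 : ℝ)..1, ‖(f : ℝ → ℂ) x‖, 0,
      intervalIntegral.integral_nonneg zero_le_one fun x _ => norm_nonneg _, fun g M hM => ?_⟩
    rw [← intervalIntegral.integral_mul_const]
    refine intervalIntegral.norm_integral_le_of_norm_le zero_le_one
      (Filter.Eventually.of_forall fun x _ => ?_) (f.2.2.norm.mul_const M)
    rw [norm_mul]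
    have := hM 0 le_rfl x
    rw [iteratedDeriv_zero] at this
    gcongr⟩

/-! ### Periodic B-splines -/

/-- The mesh size `h = 1 / n`. -/
def mesh (n : ℕ) : ℝ := 1 / (n : ℝ)

/-- `φ_1^{(0)}`: the indicator function of the union of the intervals `[-h/2 + m, h/2 + m)` over all
integers `m`. -/
def box (n : ℕ) : ℝ → ℝ :=
  Set.indicator {x : ℝ | ∃ m : ℤ, -(mesh n) / 2 + m ≤ x ∧ x < mesh n / 2 + m} fun _ => 1

/-- `φ_1^{(μ)}`, by recursive convolution with `φ_1^{(0)}`. -/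
def firstSpline (n : ℕ) : ℕ → ℝ → ℝ
  | 0 => box n
  | μ + 1 => fun x =>
      1 / mesh n * ∫ y in (-(1 / 2) : ℝ)..(1 / 2), firstSpline n μ y * box n (x - y)

/-- `φ_ℓ^{(μ)}(x) = φ_1^{(μ)}(x - x_ℓ)` with `x_ℓ = (ℓ - 1) h`, meant for `ℓ = 1, …, n`. -/
def spline (n μ ℓ : ℕ) (x : ℝ) : ℝ := firstSpline n μ (x - ((ℓ : ℝ) - 1) * mesh n)

/-- The spline `φ_ℓ^{(μ)}` as a complex-valued function. -/
def splineC (n μ ℓ : ℕ) (x : ℝ) : ℂ := (spline n μ ℓ x : ℂ)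

/-- `H_n`, the complex linear span of `φ_1^{(μ)}, …, φ_n^{(μ)}`. -/
def splineSpace (n μ : ℕ) : Submodule ℂ (ℝ → ℂ) :=
  Submodule.span ℂ (splineC n μ '' Set.Icc 1 n)

theorem box_periodic (n : ℕ) : Function.Periodic (box n) 1 := by
  intro x
  classical
  simp only [box, Set.indicator_apply]
  refine if_congr ?_ rfl rfl
  constructor
  · rintro ⟨m, h1, h2⟩
    exact ⟨m - 1, by push_cast; linarith, by push_cast; linarith⟩
  · rintro ⟨m, h1, h2⟩
    exact ⟨m + 1, by push_cast; linarith, by push_cast; linarith⟩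

theorem box_measurable (n : ℕ) : Measurable (box n) := by
  refine measurable_const.indicator ?_
  have : {x : ℝ | ∃ m : ℤ, -(mesh n) / 2 + m ≤ x ∧ x < mesh n / 2 + m} =
      ⋃ m : ℤ, Set.Ico (-(mesh n) / 2 + m) (mesh n / 2 + m) := by
    ext x; simp
  rw [this]
  exact MeasurableSet.iUnion fun _ => measurableSet_Ico

theorem norm_box_le (n : ℕ) (x : ℝ) : ‖box n x‖ ≤ 1 := by
  unfold box Set.indicator
  split_ifs <;> simp

theorem firstSpline_periodic (n μ : ℕ) : Function.Periodic (firstSpline n μ) 1 := by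
  cases μ with
  | zero => exact box_periodic n
  | succ μ =>
    intro x
    have h (y : ℝ) : box n (x + 1 - y) = box n (x - y) := by
      rw [← box_periodic n (x - y)]; congr 1; ring
    simp only [firstSpline, h]

theorem firstSpline_measurable_bounded (n μ : ℕ) :
    Measurable (firstSpline n μ) ∧ ∃ C, ∀ x, ‖firstSpline n μ x‖ ≤ C := by
  induction μ with
  | zero => exact ⟨box_measurable n, 1, norm_box_le n⟩
  | succ μ ih =>
    obtain ⟨hm, C, hC⟩ := ih
    constructor
    · have h2 : Measurable fun p : ℝ × ℝ => firstSpline n μ p.2 * box n (p.1 - p.2) :=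
        (hm.comp measurable_snd).mul
          ((box_measurable n).comp (measurable_fst.sub measurable_snd))
      have h3 := (h2.stronglyMeasurable.integral_prod_right'
        (ν := MeasureTheory.volume.restrict (Set.Ioc (-(1 / 2) : ℝ) (1 / 2)))).measurable
      have h4 : firstSpline n (μ + 1) = fun x => 1 / mesh n *
          ∫ y in Set.Ioc (-(1 / 2) : ℝ) (1 / 2), firstSpline n μ y * box n (x - y) := by
        ext x
        simp only [firstSpline]
        rw [intervalIntegral.integral_of_le (by norm_num)]
      rw [h4]
      exact h3.const_mul _
    · refine ⟨‖1 / mesh n‖ * (C * |1 / 2 - (-(1 / 2) : ℝ)|), fun x => ?_⟩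
      rw [firstSpline, norm_mul]
      gcongr
      refine intervalIntegral.norm_integral_le_of_norm_le_const fun y _ => ?_
      rw [norm_mul]
      calc ‖firstSpline n μ y‖ * ‖box n (x - y)‖ ≤ ‖firstSpline n μ y‖ * 1 := by
            gcongr; exact norm_box_le n _
        _ ≤ C := by rw [mul_one]; exact hC y

theorem splineC_mem (n μ ℓ : ℕ) : splineC n μ ℓ ∈ PeriodicIntegrable := by
  obtain ⟨hm, C, hC⟩ := firstSpline_measurable_bounded n μ
  constructor
  · intro x
    have : x + 1 - ((ℓ : ℝ) - 1) * mesh n = x - ((ℓ : ℝ) - 1) * mesh n + 1 := by ring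
    simp only [splineC, spline, this, firstSpline_periodic n μ _]
  · have h2 : Measurable (splineC n μ ℓ) :=
      Complex.measurable_ofReal.comp (hm.comp (measurable_id.sub_const _))
    refine (intervalIntegrable_const (c := C)).mono_fun h2.aestronglyMeasurable
      (Filter.Eventually.of_forall fun x => ?_)
    calc ‖splineC n μ ℓ x‖ ≤ C := by
          rw [splineC, Complex.norm_real]; exact hC _
      _ ≤ ‖C‖ := Real.le_norm_self C

theorem splineSpace_le (n μ : ℕ) : splineSpace n μ ≤ PeriodicIntegrable := by
  refine Submodule.span_le.2 ?_
  rintro _ ⟨ℓ, _, rfl⟩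
  exact splineC_mem n μ ℓ

/-- The distribution given by the spline `φ_ℓ^{(μ)}`. -/
def splineDist (n μ ℓ : ℕ) : Distribution := toDistribution ⟨splineC n μ ℓ, splineC_mem n μ ℓ⟩

/-- The distribution given by an element of the spline space. -/
def splineSpaceDist {n μ : ℕ} (v : splineSpace n μ) : Distribution :=
  toDistribution ⟨(v : ℝ → ℂ), splineSpace_le n μ v.2⟩

/-- The numbers `c_ℓ^{(μ)}(m) = h sinc^{μ+1}(π h m) e^{-2π i h m (ℓ - 1)}`. -/
def splineCoeff (n μ ℓ : ℕ) (m : ℤ) : ℂ :=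
  ((mesh n * Real.sinc (π * mesh n * (m : ℝ)) ^ (μ + 1) : ℝ) : ℂ) *
    Complex.exp (-(Complex.I * 2 * (π : ℂ) * (mesh n : ℂ) * (m : ℂ) * ((ℓ : ℂ) - 1)))

end PeriodicSpline

end

namespace PeriodicSpline

open MeasureTheory

/-! ### The box function -/

/-! Everything rests on the Fourier coefficients. Each convolution with the box multiplies them by
`sinc (π h m)`, and translation by a multiple of `h = 1/n` multiplies them by a phase that depends
only on `m` modulo `n`. Hence every element of the spline space has coefficients `sinc^{μ+1}(π h m)
A(m)` with `A` periodic modulo `n` (`exists_periodic_factor`). Since `|sin (π h m)|` is also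
periodic modulo `n`, the coefficient at an alias `p + nk` of a frequency `|p| ≤ n/2` is, in modulus,
the one at `p` times `(|p| / |p + nk|)^{μ+1}` (`HasSplineAliasing`).

For `k ≠ 0` the weight `⟨p + nk⟩` is comparable to `n|k|`, so the aliases contribute to the squared
`H^s` norm a sum over `k` of `|k|^{2s - 2(μ+1)}`, which converges exactly when `s < μ + 1/2`. This
bounds the alias part of order `s` by `n^{2(s-τ)}` times the low-frequency part of order `τ`, for
any `τ ≤ μ + 1` (`HasSplineAliasing.aliasEnergy_le`). With `⟨p⟩ ≤ 2n` at low frequencies, `τ = a`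
yields the inverse inequality and, for equal orders, Sobolev regularity.

For approximation, a spline matching the low coefficients of `u` exists by discrete Fourier
inversion, because `sinc` does not vanish there (`exists_spline_interpolating`). The error then
lives on the aliases alone, where the tail of `u` and that of the spline are both of the right
order. -/

theorem mesh_pos {n : ℕ} (hn : 0 < n) : 0 < mesh n := by
  unfold mesh; positivity

theorem mesh_le_one {n : ℕ} (hn : 0 < n) : mesh n ≤ 1 := by
  unfold mesh
  rw [div_le_one (by positivity)]
  exact_mod_cast hn

theorem natCast_mul_mesh {n : ℕ} (hn : 0 < n) : (n : ℝ) * mesh n = 1 := by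
  unfold mesh; field_simp

/-- Rescaling by `n` turns questions about the box into divisibility of an integer by `n`. -/
theorem mem_box_iff {n : ℕ} (hn : 0 < n) (x : ℝ) (m : ℤ) :
    (-(mesh n) / 2 + m ≤ x ∧ x < mesh n / 2 + m) ↔ ⌊n * x + 1 / 2⌋ = n * m := by
  have hn' : (0 : ℝ) < n := by exact_mod_cast hn
  have h := natCast_mul_mesh hn
  rw [Int.floor_eq_iff]
  push_cast
  constructor
  · rintro ⟨h1, h2⟩
    constructor <;> nlinarith
  · rintro ⟨h1, h2⟩
    constructor <;> nlinarith

open Classical in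
theorem box_eq_ite {n : ℕ} (hn : 0 < n) (x : ℝ) :
    box n x = if (n : ℤ) ∣ ⌊n * x + 1 / 2⌋ then 1 else 0 := by
  rw [box, Set.indicator_apply]
  refine if_congr ?_ rfl rfl
  exact exists_congr fun m => mem_box_iff hn x m

theorem sum_box_shift {n : ℕ} (hn : 0 < n) (x : ℝ) :
    ∑ l ∈ Finset.Icc 1 n, box n (x - ((l : ℝ) - 1) * mesh n) = 1 := by
  classical
  set F := ⌊n * x + 1 / 2⌋ with hF
  have hn' : (0 : ℤ) < n := by exact_mod_cast hn
  have key (l : ℕ) : box n (x - ((l : ℝ) - 1) * mesh n) =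
      if (n : ℤ) ∣ F - ((l : ℤ) - 1) then 1 else 0 := by
    have h : n * (x - ((l : ℝ) - 1) * mesh n) + 1 / 2 =
        n * x + 1 / 2 - (((l : ℤ) - 1 : ℤ) : ℝ) := by
      push_cast
      linear_combination (1 - (l : ℝ)) * natCast_mul_mesh hn
    rw [box_eq_ite hn, hF, h, Int.floor_sub_intCast]
  have h0 := Int.emod_nonneg F hn'.ne'
  have h1 := Int.emod_lt_of_pos F hn'
  have h2 : (n : ℤ) ∣ F - F % n := Int.dvd_self_sub_emod
  -- Exactly one shift `l - 1` in `0, …, n - 1` is congruent to `F` modulo `n`.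
  rw [Finset.sum_eq_single ((F % n).toNat + 1)]
  · rw [key, if_pos]
    push_cast
    rw [Int.toNat_of_nonneg h0]
    simpa using h2
  · intro l hl hne
    rw [Finset.mem_Icc] at hl
    rw [key, if_neg]
    intro hd
    have h3 := Int.eq_zero_of_abs_lt_dvd (dvd_sub h2 hd) (by rw [abs_lt]; constructor <;> omega)
    omega
  · intro h
    rw [Finset.mem_Icc] at h
    omega

theorem box_neg {n : ℕ} {x : ℝ}
    (hx : ∀ m : ℤ, x ≠ mesh n / 2 + m ∧ x ≠ -(mesh n) / 2 + m) : box n (-x) = box n x := by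
  classical
  simp only [box, Set.indicator_apply]
  refine if_congr ?_ rfl rfl
  constructor
  · rintro ⟨m, h1, h2⟩
    refine ⟨-m, ?_, lt_of_le_of_ne ?_ (hx _).1⟩ <;> push_cast <;> linarith
  · rintro ⟨m, h1, h2⟩
    have h3 := lt_of_le_of_ne h1 (hx m).2.symm
    refine ⟨-m, ?_, ?_⟩ <;> push_cast <;> linarith

/-- Reflection swaps the closed and open ends of the intervals, which matters only on a countable
set. Integrals ignore it, so one convolution already gives evenness everywhere. -/
theorem box_neg_ae (n : ℕ) : ∀ᵐ x : ℝ, box n (-x) = box n x := by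
  have hc : (Set.range (fun m : ℤ => mesh n / 2 + m) ∪
      Set.range (fun m : ℤ => -(mesh n) / 2 + m)).Countable :=
    (Set.countable_range _).union (Set.countable_range _)
  filter_upwards [hc.ae_notMem volume] with x hx
  refine box_neg fun m => ⟨fun h => hx (Or.inl ⟨m, h.symm⟩), fun h => hx (Or.inr ⟨m, h.symm⟩)⟩

theorem box_eq_indicator {n : ℕ} (hn : 0 < n) {x : ℝ} (hx : x ∈ Set.Ico (-(1 / 2) : ℝ) (1 / 2)) :
    box n x = Set.indicator (Set.Ico (-(mesh n) / 2) (mesh n / 2)) (fun _ => 1) x := by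
  classical
  have h1 := mesh_le_one hn
  rw [box, Set.indicator_apply, Set.indicator_apply]
  refine if_congr ⟨?_, fun h => ⟨0, by simpa using h⟩⟩ rfl rfl
  rintro ⟨m, h2, h3⟩
  obtain ⟨h4, h5⟩ := hx
  have h6 : (-1 : ℝ) < m := by linarith
  have h7 : (m : ℝ) < 1 := by linarith
  have h8 : -1 < m := by exact_mod_cast h6
  have h9 : m < 1 := by exact_mod_cast h7
  obtain rfl : m = 0 := by omega
  exact ⟨by simpa using h2, by simpa using h3⟩

/-- Stated for vector-valued `g` because it serves both the real splines and the complex monomials.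
-/
theorem integral_box_smul {E : Type*} [NormedAddCommGroup E] [NormedSpace ℝ E] {n : ℕ}
    (hn : 0 < n) (g : ℝ → E) :
    ∫ x in (-(1 / 2) : ℝ)..(1 / 2), box n x • g x = ∫ x in (-(mesh n) / 2)..(mesh n / 2), g x := by
  have h0 := mesh_pos hn
  have h1 := mesh_le_one hn
  rw [intervalIntegral.integral_of_le (by norm_num), intervalIntegral.integral_of_le (by linarith),
    ← integral_Ico_eq_integral_Ioc, ← integral_Ico_eq_integral_Ioc]
  have h2 : ∀ x ∈ Set.Ico (-(1 / 2) : ℝ) (1 / 2), box n x • g x =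
      Set.indicator (Set.Ico (-(mesh n) / 2) (mesh n / 2)) g x := by
    intro x hx
    rw [box_eq_indicator hn hx]
    by_cases h : x ∈ Set.Ico (-(mesh n) / 2) (mesh n / 2) <;> simp [h]
  rw [setIntegral_congr_fun measurableSet_Ico h2, setIntegral_indicator measurableSet_Ico,
    Set.inter_eq_right.2 (Set.Ico_subset_Ico (by linarith) (by linarith))]

/-! ### Evenness and continuity of the splines -/

theorem firstSpline_succ_neg {n μ : ℕ}
    (hμ : ∀ᵐ x : ℝ, firstSpline n μ (-x) = firstSpline n μ x) (x : ℝ) :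
    firstSpline n (μ + 1) (-x) = firstSpline n (μ + 1) x := by
  simp only [firstSpline]
  congr 1
  have h := intervalIntegral.integral_comp_neg (a := (-(1 / 2) : ℝ)) (b := 1 / 2)
    fun y => firstSpline n μ y * box n (-x - y)
  rw [neg_neg] at h
  rw [← h]
  refine intervalIntegral.integral_congr_ae ?_
  have h2 : ∀ᵐ y : ℝ, box n (-(x - y)) = box n (x - y) :=
    (quasiMeasurePreserving_sub_left volume x).ae (box_neg_ae n)
  filter_upwards [hμ, h2] with y h3 h4 _
  rw [h3, ← h4]
  congr 2
  ring

theorem firstSpline_neg_ae (n μ : ℕ) : ∀ᵐ x : ℝ, firstSpline n μ (-x) = firstSpline n μ x := by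
  induction μ with
  | zero => exact box_neg_ae n
  | succ μ ih => exact Filter.Eventually.of_forall (firstSpline_succ_neg ih)

theorem firstSpline_neg {n μ : ℕ} {x : ℝ}
    (hx : μ = 0 → ∀ m : ℤ, x ≠ mesh n / 2 + m ∧ x ≠ -(mesh n) / 2 + m) :
    firstSpline n μ (-x) = firstSpline n μ x := by
  cases μ with
  | zero => exact box_neg (hx rfl)
  | succ μ => exact firstSpline_succ_neg (firstSpline_neg_ae n μ) x

theorem spline_one (n μ : ℕ) (x : ℝ) : spline n μ 1 x = firstSpline n μ x := by
  simp [spline]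

theorem firstSpline_intervalIntegrable (n μ : ℕ) (a b : ℝ) :
    IntervalIntegrable (firstSpline n μ) volume a b := by
  obtain ⟨hm, C, hC⟩ := firstSpline_measurable_bounded n μ
  exact (intervalIntegrable_const (c := C)).mono_fun hm.aestronglyMeasurable
    (Filter.Eventually.of_forall fun x => (hC x).trans (Real.le_norm_self C))

/-- The convolution is a moving average over a window of length `h`: substitute `y ↦ x - y`, then
recentre the period by periodicity. Continuity follows, since primitives are continuous. -/
theorem firstSpline_succ_eq {n : ℕ} (hn : 0 < n) (μ : ℕ) (x : ℝ) :
    firstSpline n (μ + 1) x =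
      1 / mesh n * ∫ y in (x - mesh n / 2)..(x + mesh n / 2), firstSpline n μ y := by
  have hp : Function.Periodic (fun y => box n y * firstSpline n μ (x - y)) 1 := by
    intro y
    simp only [box_periodic n y]
    rw [← firstSpline_periodic n μ (x - (y + 1))]
    congr 2
    ring
  have h1 := intervalIntegral.integral_comp_sub_left (a := (-(1 / 2) : ℝ)) (b := 1 / 2)
    (fun y => box n y * firstSpline n μ (x - y)) x
  simp only [sub_sub_cancel] at h1
  have h2 := hp.intervalIntegral_add_eq (x - 1 / 2) (-(1 / 2))
  have h3 := integral_box_smul hn (fun y => firstSpline n μ (x - y))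
  have h4 := intervalIntegral.integral_comp_sub_left (a := -(mesh n) / 2) (b := mesh n / 2)
    (firstSpline n μ) x
  simp only [smul_eq_mul] at h3
  have h5 : ∫ y in (-(1 / 2) : ℝ)..(1 / 2), firstSpline n μ y * box n (x - y) =
      ∫ y in (x - mesh n / 2)..(x + mesh n / 2), firstSpline n μ y := by
    calc _ = ∫ y in (-(1 / 2) : ℝ)..(1 / 2), box n (x - y) * firstSpline n μ y := by
          simp only [mul_comm]
      _ = ∫ y in (x - 1 / 2)..(x - 1 / 2 + 1), box n y * firstSpline n μ (x - y) := by
          rw [h1]; congr 1; ring_nf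
      _ = ∫ y in (-(1 / 2) : ℝ)..(1 / 2), box n y * firstSpline n μ (x - y) := by
          rw [h2]; norm_num
      _ = _ := by rw [h3, h4]; congr 1; ring_nf
  simp only [firstSpline, h5]

theorem firstSpline_succ_continuous {n : ℕ} (hn : 0 < n) (μ : ℕ) :
    Continuous (firstSpline n (μ + 1)) := by
  have hi := firstSpline_intervalIntegrable n μ
  have h0 := intervalIntegral.continuous_primitive hi 0
  have h1 : firstSpline n (μ + 1) = fun x => 1 / mesh n *
      ((∫ y in (0 : ℝ)..(x + mesh n / 2), firstSpline n μ y) -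
        ∫ y in (0 : ℝ)..(x - mesh n / 2), firstSpline n μ y) := by
    ext x
    rw [firstSpline_succ_eq hn, intervalIntegral.integral_interval_sub_left (hi _ _) (hi _ _)]
  rw [h1]
  exact continuous_const.mul ((h0.comp (continuous_id.add continuous_const)).sub
    (h0.comp (continuous_id.sub continuous_const)))

/-! ### Fourier coefficients -/

theorem monomialFun_periodic (m : ℤ) : Function.Periodic (monomialFun m) 1 :=
  (monomialFun_mem m).2

theorem monomialFun_continuous (m : ℤ) : Continuous (monomialFun m) :=
  (monomialFun_mem m).1.continuous

theorem monomialFun_add (m : ℤ) (x y : ℝ) :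
    monomialFun m (x + y) = monomialFun m x * monomialFun m y := by
  rw [monomialFun, monomialFun, monomialFun, ← Complex.exp_add]
  congr 1
  push_cast
  ring

theorem norm_monomialFun (m : ℤ) (x : ℝ) : ‖monomialFun m x‖ = 1 := by
  have h : (2 * (π : ℂ) * Complex.I * (m : ℂ) * (x : ℂ)) =
      ((2 * π * m * x : ℝ) : ℂ) * Complex.I := by push_cast; ring
  rw [monomialFun, h, Complex.norm_exp_ofReal_mul_I]

theorem integral_monomialFun {h : ℝ} (hh : h ≠ 0) (m : ℤ) :
    ∫ x in (-h / 2)..(h / 2), monomialFun m x = ((h * Real.sinc (π * h * m) : ℝ) : ℂ) := by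
  rcases eq_or_ne m 0 with rfl | hm
  · simp [monomialFun, Real.sinc_zero]
    ring
  · have hm' : (m : ℂ) ≠ 0 := by exact_mod_cast hm
    have hm'' : (m : ℝ) ≠ 0 := by exact_mod_cast hm
    have hh' : (h : ℂ) ≠ 0 := by exact_mod_cast hh
    have hπ : (π : ℂ) ≠ 0 := by exact_mod_cast Real.pi_ne_zero
    have hc : (2 * (π : ℂ) * Complex.I * (m : ℂ)) ≠ 0 := by
      simp [hπ, hm', Complex.I_ne_zero]
    have h1 : π * h * m ≠ 0 := by
      simp [Real.pi_ne_zero, hh, hm]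
    unfold monomialFun
    rw [integral_exp_mul_complex hc, Real.sinc_of_ne_zero h1]
    push_cast
    have h2 : 2 * (π : ℂ) * Complex.I * m * (h / 2) = π * h * m * Complex.I := by ring
    have h3 : 2 * (π : ℂ) * Complex.I * m * (-h / 2) = -(π * h * m) * Complex.I := by ring
    rw [h2, h3, Complex.sin]
    field_simp
    ring_nf
    simp only [Complex.I_sq]
    ring

/-- The Fourier coefficients of the spline `φ_1^{(μ)}`. -/
noncomputable def firstSplineCoeff (n μ : ℕ) (m : ℤ) : ℂ :=
  ∫ x in (0 : ℝ)..1, (firstSpline n μ x : ℂ) * monomialFun (-m) x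

theorem firstSpline_mul_monomialFun_periodic (n μ : ℕ) (m : ℤ) :
    Function.Periodic (fun x => (firstSpline n μ x : ℂ) * monomialFun m x) 1 := fun x => by
  simp only [firstSpline_periodic n μ x, monomialFun_periodic m x]

theorem integral_firstSpline_eq_firstSplineCoeff (n μ : ℕ) (m : ℤ) {a b : ℝ} (hab : a + 1 = b) :
    ∫ x in a..b, (firstSpline n μ x : ℂ) * monomialFun (-m) x = firstSplineCoeff n μ m := by
  have h := (firstSpline_mul_monomialFun_periodic n μ (-m)).intervalIntegral_add_eq a 0
  rw [hab, zero_add] at h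
  exact h

theorem firstSplineCoeff_zero {n : ℕ} (hn : 0 < n) (m : ℤ) :
    firstSplineCoeff n 0 m = ((mesh n * Real.sinc (π * mesh n * m) : ℝ) : ℂ) := by
  have h := integral_box_smul hn (monomialFun (-m))
  rw [integral_monomialFun (mesh_pos hn).ne'] at h
  rw [← integral_firstSpline_eq_firstSplineCoeff n 0 m (a := -(1 / 2)) (b := 1 / 2) (by norm_num)]
  simp only [Complex.real_smul] at h
  rw [firstSpline, h, Int.cast_neg, mul_neg, Real.sinc_neg]

/-- The convolution theorem: the character at `x` splits into those at `y` and `x - y`, and Fubini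
applies because the integrand is bounded on a bounded rectangle. -/
theorem firstSplineCoeff_succ (n μ : ℕ) (m : ℤ) :
    firstSplineCoeff n (μ + 1) m =
      ((1 / mesh n : ℝ) : ℂ) * (firstSplineCoeff n μ m * firstSplineCoeff n 0 m) := by
  obtain ⟨hm, C, hC⟩ := firstSpline_measurable_bounded n μ
  have hC0 : 0 ≤ C := (norm_nonneg _).trans (hC 0)
  set G : ℝ → ℝ → ℂ := fun x y => ((firstSpline n μ y : ℂ) * monomialFun (-m) y) *
    ((box n (x - y) : ℂ) * monomialFun (-m) (x - y)) with hG
  have hGm : Measurable (Function.uncurry G) := by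
    have h1 := (monomialFun_continuous (-m)).measurable
    have h2 : Measurable fun p : ℝ × ℝ => p.1 - p.2 := measurable_fst.sub measurable_snd
    exact ((Complex.measurable_ofReal.comp (hm.comp measurable_snd)).mul
      (h1.comp measurable_snd)).mul
      ((Complex.measurable_ofReal.comp ((box_measurable n).comp h2)).mul (h1.comp h2))
  have hGb (p : ℝ × ℝ) : ‖Function.uncurry G p‖ ≤ C := by
    simp only [Function.uncurry, hG, norm_mul, norm_monomialFun, mul_one, Complex.norm_real]
    calc _ ≤ C * 1 := by gcongr; exacts [hC _, norm_box_le n _]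
      _ = C := mul_one C
  have hGi : IntegrableOn (Function.uncurry G)
      (Set.uIoc (0 : ℝ) 1 ×ˢ Set.uIoc (-(1 / 2) : ℝ) (1 / 2)) :=
    Measure.integrableOn_of_bounded (M := C)
      (((Metric.isBounded_Ioc _ _).prod (Metric.isBounded_Ioc _ _)).measure_lt_top.ne)
      hGm.aestronglyMeasurable (Filter.Eventually.of_forall hGb)
  have h1 (x : ℝ) : (firstSpline n (μ + 1) x : ℂ) * monomialFun (-m) x =
      ((1 / mesh n : ℝ) : ℂ) * ∫ y in (-(1 / 2) : ℝ)..(1 / 2), G x y := by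
    rw [firstSpline, Complex.ofReal_mul, mul_assoc, ← intervalIntegral.integral_ofReal,
      ← intervalIntegral.integral_mul_const]
    congr 2
    ext y
    simp only [hG]
    rw [← add_sub_cancel y x, monomialFun_add]
    push_cast
    rw [add_sub_cancel_left]
    ring
  have h2 (y : ℝ) : ∫ x in (0 : ℝ)..1, G x y =
      ((firstSpline n μ y : ℂ) * monomialFun (-m) y) * firstSplineCoeff n 0 m := by
    simp only [hG]
    rw [intervalIntegral.integral_const_mul,
      intervalIntegral.integral_comp_sub_right
        (fun x => (box n x : ℂ) * monomialFun (-m) x) y,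
      ← integral_firstSpline_eq_firstSplineCoeff n 0 m (a := 0 - y) (b := 1 - y) (by ring)]
    rfl
  rw [firstSplineCoeff]
  simp only [h1]
  rw [intervalIntegral.integral_const_mul, intervalIntegral_intervalIntegral_swap hGi]
  simp only [h2]
  rw [intervalIntegral.integral_mul_const,
    integral_firstSpline_eq_firstSplineCoeff n μ m (by norm_num)]

theorem firstSplineCoeff_eq {n : ℕ} (hn : 0 < n) (μ : ℕ) (m : ℤ) :
    firstSplineCoeff n μ m = ((mesh n * Real.sinc (π * mesh n * m) ^ (μ + 1) : ℝ) : ℂ) := by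
  have h0 := (mesh_pos hn).ne'
  induction μ with
  | zero => rw [firstSplineCoeff_zero hn, zero_add, pow_one]
  | succ μ ih =>
    rw [firstSplineCoeff_succ, ih, firstSplineCoeff_zero hn, ← Complex.ofReal_mul,
      ← Complex.ofReal_mul]
    congr 1
    field_simp
    rw [pow_succ (Real.sinc _) (μ + 1)]

theorem integral_splineC_mul_monomialFun {n : ℕ} (hn : 0 < n) (μ l : ℕ) (m : ℤ) :
    ∫ x in (0 : ℝ)..1, splineC n μ l x * monomialFun (-m) x = splineCoeff n μ l m := by
  set t := ((l : ℝ) - 1) * mesh n with ht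
  have h1 (x : ℝ) : splineC n μ l x * monomialFun (-m) x =
      monomialFun (-m) t * ((firstSpline n μ (x - t) : ℂ) * monomialFun (-m) (x - t)) := by
    conv_lhs => rw [← add_sub_cancel t x, monomialFun_add]
    rw [splineC, spline, add_sub_cancel]
    ring
  simp only [h1]
  rw [intervalIntegral.integral_const_mul,
    intervalIntegral.integral_comp_sub_right
      (fun x => (firstSpline n μ x : ℂ) * monomialFun (-m) x) t,
    integral_firstSpline_eq_firstSplineCoeff n μ m (by ring), firstSplineCoeff_eq hn, splineCoeff,
    mul_comm, monomialFun, ht]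
  congr 2
  push_cast
  ring

theorem fourier_coe_eq_monomialFun (m : ℤ) (x : ℝ) :
    fourier m (x : AddCircle (1 : ℝ)) = monomialFun m x := by
  rw [fourier_coe_apply, monomialFun]
  simp

theorem fourierCoeffOn_eq_integral_monomialFun (f : ℝ → ℂ) (m : ℤ) :
    fourierCoeffOn (zero_lt_one' ℝ) f m = ∫ x in (0 : ℝ)..1, f x * monomialFun (-m) x := by
  have h (x : ℝ) : fourier (-m) (x : AddCircle ((1 : ℝ) - 0)) = monomialFun (-m) x := by
    rw [fourier_coe_apply, monomialFun]
    simp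
  rw [fourierCoeffOn_eq_integral]
  simp only [h, smul_eq_mul, mul_comm]
  norm_num

theorem fourierCoeffOn_splineC {n : ℕ} (hn : 0 < n) (μ l : ℕ) (m : ℤ) :
    fourierCoeffOn (zero_lt_one' ℝ) (splineC n μ l) m = splineCoeff n μ l m := by
  rw [fourierCoeffOn_eq_integral_monomialFun, integral_splineC_mul_monomialFun hn]

/-! ### Partition of unity -/

/-- This is the Fourier coefficient at frequency zero. -/
theorem integral_firstSpline {n : ℕ} (hn : 0 < n) (μ : ℕ) :
    ∫ x in (-(1 / 2) : ℝ)..(1 / 2), firstSpline n μ x = mesh n := by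
  have h := firstSplineCoeff_eq hn μ 0
  rw [← integral_firstSpline_eq_firstSplineCoeff n μ 0 (a := -(1 / 2)) (b := 1 / 2)
    (by norm_num)] at h
  simp only [monomialFun, neg_zero, Int.cast_zero, mul_zero, zero_mul, Complex.exp_zero, mul_one,
    intervalIntegral.integral_ofReal, Real.sinc_zero, one_pow] at h
  exact_mod_cast h

theorem sum_spline_eq_one {n : ℕ} (hn : 0 < n) (μ : ℕ) (x : ℝ) :
    ∑ l ∈ Finset.Icc 1 n, spline n μ l x = 1 := by
  cases μ with
  | zero => exact sum_box_shift hn x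
  | succ μ =>
    have hi (l : ℕ) : IntervalIntegrable (fun y => firstSpline n μ y *
        box n (x - ((l : ℝ) - 1) * mesh n - y)) volume (-(1 / 2)) (1 / 2) := by
      refine (firstSpline_intervalIntegrable n μ _ _).mono_fun
        ((firstSpline_measurable_bounded n μ).1.mul ((box_measurable n).comp
          (measurable_const.sub measurable_id))).aestronglyMeasurable
        (Filter.Eventually.of_forall fun y => ?_)
      simp only [norm_mul]
      exact mul_le_of_le_one_right (norm_nonneg _) (norm_box_le n _)
    simp only [spline, firstSpline]
    rw [← Finset.mul_sum, ← intervalIntegral.integral_finsetSum fun l _ => hi l]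
    -- Only the partition of unity for the box is needed: the shifts fall on the box factor of the
    -- convolution.
    have h (y : ℝ) : ∑ l ∈ Finset.Icc 1 n, firstSpline n μ y *
        box n (x - ((l : ℝ) - 1) * mesh n - y) = firstSpline n μ y := by
      have h' (l : ℕ) : x - ((l : ℝ) - 1) * mesh n - y = x - y - ((l : ℝ) - 1) * mesh n := by ring
      simp only [h']
      rw [← Finset.mul_sum, sum_box_shift hn (x - y), mul_one]
    simp only [h]
    rw [integral_firstSpline hn, one_div_mul_cancel (mesh_pos hn).ne']

/-! ### Convergence of the Fourier series -/

theorem haarAddCircle_one_eq_volume :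
    (AddCircle.haarAddCircle : Measure (AddCircle (1 : ℝ))) = volume := by
  rw [AddCircle.volume_eq_smul_haarAddCircle, ENNReal.ofReal_one, one_smul]

theorem fourierCoeff_liftIoc_one (f : ℝ → ℂ) (m : ℤ) :
    fourierCoeff (AddCircle.liftIoc (1 : ℝ) 0 f) m = fourierCoeffOn (zero_lt_one' ℝ) f m := by
  rw [fourierCoeff_liftIoc_eq]
  congr 1
  exact zero_add 1

/-- The `L²` theorem on the circle, pulled back along the measure-preserving quotient map; for
period one, normalized Haar measure is `volume`. -/
theorem tendsto_eLpNorm_fourier_series {f : ℝ → ℂ}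
    (hf : MemLp f 2 (volume.restrict (Set.Ioc (0 : ℝ) 1))) :
    Filter.Tendsto
      (fun S : Finset ℤ => eLpNorm
        (fun x : ℝ => f x - ∑ m ∈ S, fourierCoeffOn (zero_lt_one' ℝ) f m * monomialFun m x)
        2 (volume.restrict (Set.Ioc (0 : ℝ) 1)))
      Filter.atTop (nhds 0) := by
  have hf' : MemLp f 2 (volume.restrict (Set.Ioc (0 : ℝ) (0 + 1))) := by rwa [zero_add]
  have hg := hf'.memLp_liftIoc.haarAddCircle
  set g := AddCircle.liftIoc (1 : ℝ) 0 f with hgdef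
  have hs := hasSum_fourier_series_L2 hg.toLp
  rw [HasSum, SummationFilter.unconditional_filter, Lp.tendsto_Lp_iff_tendsto_eLpNorm'] at hs
  refine hs.congr fun S => ?_
  have h1 : ((∑ m ∈ S, fourierCoeff (hg.toLp) m • fourierLp 2 m :
      Lp ℂ 2 AddCircle.haarAddCircle) : AddCircle (1 : ℝ) → ℂ) - (hg.toLp : AddCircle (1 : ℝ) → ℂ)
      =ᵐ[AddCircle.haarAddCircle]
      -fun x => g x - ∑ m ∈ S, fourierCoeffOn (zero_lt_one' ℝ) f m * fourier m x := by
    have h2 : ∀ᵐ x ∂AddCircle.haarAddCircle, ∀ m : ℤ,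
        (fourierCoeff (hg.toLp) m • fourierLp (T := 1) 2 m :
          Lp ℂ 2 AddCircle.haarAddCircle) x =
          fourierCoeffOn (zero_lt_one' ℝ) f m * fourier m x := by
      rw [ae_all_iff]
      intro m
      filter_upwards [Lp.coeFn_smul (fourierCoeff (hg.toLp) m) (fourierLp (T := 1) 2 m),
        coeFn_fourierLp (T := 1) 2 m] with x hx hx'
      rw [hx, Pi.smul_apply, hx', fourierCoeff_congr_ae hg.coeFn_toLp, fourierCoeff_liftIoc_one,
        smul_eq_mul]
    filter_upwards [Lp.coeFn_finsetSum S
      (fun m => fourierCoeff (hg.toLp) m • fourierLp (T := 1) 2 m), h2, hg.coeFn_toLp]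
      with x h3 h4 h5
    rw [Pi.sub_apply, h3, h5, Finset.sum_apply, Pi.neg_apply, neg_sub]
    congr 1
    exact Finset.sum_congr rfl fun m _ => h4 m
  have h6 : AEStronglyMeasurable (fun x => g x -
      ∑ m ∈ S, fourierCoeffOn (zero_lt_one' ℝ) f m * fourier m x)
      (volume : Measure (AddCircle (1 : ℝ))) := by
    refine hf'.memLp_liftIoc.1.sub (Continuous.aestronglyMeasurable ?_)
    exact continuous_finsetSum _ fun m _ => continuous_const.mul (fourier m).continuous
  rw [eLpNorm_congr_ae h1, eLpNorm_neg, haarAddCircle_one_eq_volume,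
    ← eLpNorm_comp_measurePreserving h6 (AddCircle.measurePreserving_mk 1 0), zero_add]
  refine eLpNorm_congr_ae ?_
  filter_upwards [ae_restrict_mem measurableSet_Ioc] with x hx
  simp only [Function.comp_apply, fourier_coe_eq_monomialFun]
  rw [hgdef, AddCircle.liftIoc_coe_apply (by rwa [zero_add])]

theorem hasSum_fourier_series_of_periodic {f : ℝ → ℂ} (hp : Function.Periodic f 1)
    (hc : Continuous f) (hs : Summable (fourierCoeffOn (zero_lt_one' ℝ) f)) (x : ℝ) :
    HasSum (fun m : ℤ => fourierCoeffOn (zero_lt_one' ℝ) f m * monomialFun m x) (f x) := by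
  let F : C(AddCircle (1 : ℝ), ℂ) := ⟨hp.lift, continuous_coinduced_dom.2 hc⟩
  have h (m : ℤ) : fourierCoeff F m = fourierCoeffOn (zero_lt_one' ℝ) f m := by
    rw [fourierCoeff_eq_intervalIntegral F m 0, fourierCoeffOn_eq_integral_monomialFun]
    simp only [fourier_coe_eq_monomialFun, smul_eq_mul, zero_add]
    simp [F, mul_comm]
  have h2 : Summable (fourierCoeff F) := by
    rw [show fourierCoeff F = fourierCoeffOn (zero_lt_one' ℝ) f from funext h]
    exact hs
  have h3 := has_pointwise_sum_fourier_series_of_summable h2 (x : AddCircle (1 : ℝ))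
  simp only [fourier_coe_eq_monomialFun, smul_eq_mul, h] at h3
  exact h3

theorem splineC_measurable_bounded (n μ l : ℕ) :
    Measurable (splineC n μ l) ∧ ∃ C, ∀ x, ‖splineC n μ l x‖ ≤ C := by
  obtain ⟨hm, C, hC⟩ := firstSpline_measurable_bounded n μ
  refine ⟨Complex.measurable_ofReal.comp (hm.comp (measurable_id.sub_const _)), C, fun x => ?_⟩
  rw [splineC, Complex.norm_real]
  exact hC _

theorem splineC_memLp (n μ l : ℕ) :
    MemLp (splineC n μ l) 2 (volume.restrict (Set.Ioc (0 : ℝ) 1)) := by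
  obtain ⟨hm, C, hC⟩ := splineC_measurable_bounded n μ l
  exact MemLp.of_bound hm.aestronglyMeasurable C (Filter.Eventually.of_forall hC)

theorem abs_sinc_le_inv_abs {x : ℝ} (hx : x ≠ 0) : |Real.sinc x| ≤ |x|⁻¹ := by
  rw [Real.sinc_of_ne_zero hx, abs_div, ← one_div]
  gcongr
  exact Real.abs_sin_le_one x

theorem norm_splineCoeff {n : ℕ} (hn : 0 < n) (μ l : ℕ) (m : ℤ) :
    ‖splineCoeff n μ l m‖ = mesh n * |Real.sinc (π * mesh n * m)| ^ (μ + 1) := by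
  have h : -(Complex.I * 2 * (π : ℂ) * (mesh n : ℂ) * (m : ℂ) * ((l : ℂ) - 1)) =
      ((-(2 * π * mesh n * m * (l - 1)) : ℝ) : ℂ) * Complex.I := by push_cast; ring
  rw [splineCoeff, norm_mul, h, Complex.norm_exp_ofReal_mul_I, mul_one, Complex.norm_real, norm_mul,
    norm_pow, Real.norm_eq_abs, Real.norm_eq_abs, abs_of_pos (mesh_pos hn)]

theorem summable_splineCoeff {n μ : ℕ} (hn : 0 < n) (hμ : 1 ≤ μ) (l : ℕ) :
    Summable (splineCoeff n μ l) := by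
  have hh := mesh_pos hn
  have hs := (Real.summable_one_div_int_pow (p := 2)).2 one_lt_two
  refine Summable.of_norm_bounded_eventually (hs.mul_left (mesh n * ((π * mesh n) ^ 2)⁻¹)) ?_
  -- The bound by a multiple of `1 / m ^ 2` fails only at `m = 0`, where the right side is zero by
  -- the division convention.
  refine (Set.finite_singleton (0 : ℤ)).subset fun m hm => ?_
  by_contra h0
  refine hm ?_
  have hm0 : (m : ℝ) ≠ 0 := by exact_mod_cast h0
  have hx : π * mesh n * m ≠ 0 := mul_ne_zero (mul_pos Real.pi_pos hh).ne' hm0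
  rw [Set.mem_ofPred_eq, norm_splineCoeff hn, mul_assoc (mesh n) (((π * mesh n) ^ 2)⁻¹)]
  gcongr
  calc |Real.sinc (π * mesh n * m)| ^ (μ + 1) ≤ |Real.sinc (π * mesh n * m)| ^ 2 :=
        pow_le_pow_of_le_one (abs_nonneg _) (Real.abs_sinc_le_one _) (by omega)
    _ ≤ (|π * mesh n * m|⁻¹) ^ 2 := by gcongr; exact abs_sinc_le_inv_abs hx
    _ = ((π * mesh n) ^ 2)⁻¹ * (1 / (m : ℝ) ^ 2) := by
        rw [inv_pow, sq_abs, mul_pow, mul_inv, one_div]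

/-- For complex series, the unconditional convergence expressed by `HasSum` is the same as absolute
convergence. -/
theorem splineC_hasSum {n μ : ℕ} (hn : 0 < n) (hμ : 1 ≤ μ) (l : ℕ) (x : ℝ) :
    HasSum (fun m : ℤ => splineCoeff n μ l m * monomialFun m x) (splineC n μ l x) := by
  have hc : Continuous (splineC n μ l) := by
    obtain ⟨ν, rfl⟩ := Nat.exists_eq_add_of_le' hμ
    exact Complex.continuous_ofReal.comp ((firstSpline_succ_continuous hn ν).comp
      (continuous_id.sub continuous_const))
  have he : fourierCoeffOn (zero_lt_one' ℝ) (splineC n μ l) = splineCoeff n μ l :=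
    funext (fourierCoeffOn_splineC hn μ l)
  have h := hasSum_fourier_series_of_periodic (splineC_mem n μ l).1 hc
    (he ▸ summable_splineCoeff hn hμ l) x
  rwa [he] at h

/-! ### Estimates for the weights -/

theorem one_le_bracket (m : ℤ) : 1 ≤ bracket m := by
  rw [bracket, Real.one_le_sqrt]
  nlinarith [sq_nonneg (m : ℝ)]

theorem bracket_pos (m : ℤ) : 0 < bracket m := one_pos.trans_le (one_le_bracket m)

theorem abs_le_bracket (m : ℤ) : |(m : ℝ)| ≤ bracket m := by
  rw [bracket]
  exact Real.abs_le_sqrt (by linarith)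

theorem bracket_le_of_abs_le {m : ℤ} {x : ℝ} (hx : 1 ≤ x) (hm : |(m : ℝ)| ≤ x) :
    bracket m ≤ 2 * x := by
  rw [bracket]
  refine Real.sqrt_le_iff.2 ⟨by linarith, ?_⟩
  have := sq_le_sq' (by linarith [abs_nonneg (m : ℝ)]) hm
  rw [sq_abs] at this
  nlinarith

/-- The sign of `t` decides which end of the interval gives the bound; adding both constants covers
either case. -/
theorem rpow_le_of_mem_Icc {c d x y : ℝ} (t : ℝ) (hc : 0 < c) (hd : 0 < d) (hy : 0 < y)
    (hcx : c * y ≤ x) (hxd : x ≤ d * y) : x ^ t ≤ (c ^ t + d ^ t) * y ^ t := by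
  have hx : 0 < x := (mul_pos hc hy).trans_le hcx
  have h1 : 0 ≤ c ^ t * y ^ t := by positivity
  have h2 : 0 ≤ d ^ t * y ^ t := by positivity
  rw [add_mul]
  rcases le_total 0 t with ht | ht
  · have := Real.rpow_le_rpow hx.le hxd ht
    rw [Real.mul_rpow hd.le hy.le] at this
    linarith
  · have := Real.rpow_le_rpow_of_nonpos (mul_pos hc hy) hcx ht
    rw [Real.mul_rpow hc.le hy.le] at this
    linarith

/-- Bounds for `p + n k` in terms of `n |k|` when `p` is a balanced residue. -/
theorem abs_add_mul_bounds {n : ℕ} {p k : ℤ} (hp : 2 * |p| ≤ n) (hk : k ≠ 0) :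
    (1 / 2) * (n * |(k : ℝ)|) ≤ |((p + n * k : ℤ) : ℝ)| ∧
      |((p + n * k : ℤ) : ℝ)| ≤ (3 / 2) * (n * |(k : ℝ)|) := by
  have hp' : 2 * |(p : ℝ)| ≤ n := by exact_mod_cast hp
  have hk1 : 1 ≤ |(k : ℝ)| := by exact_mod_cast Int.one_le_abs hk
  have h1 : (n : ℝ) ≤ n * |(k : ℝ)| := le_mul_of_one_le_right (Nat.cast_nonneg n) hk1
  have h2 : |(n : ℝ) * k| = n * |(k : ℝ)| := by rw [abs_mul, Nat.abs_cast]
  have h3 := abs_add_le (p : ℝ) (n * k)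
  have h4 := abs_sub_abs_le_abs_sub ((n : ℝ) * k) (-p)
  rw [abs_neg, sub_neg_eq_add, add_comm ((n : ℝ) * k)] at h4
  push_cast
  constructor <;> linarith

theorem bracket_add_mul_bounds {n : ℕ} (hn : 0 < n) {p k : ℤ} (hp : 2 * |p| ≤ n) (hk : k ≠ 0) :
    (1 / 2) * (n * |(k : ℝ)|) ≤ bracket (p + n * k) ∧
      bracket (p + n * k) ≤ 3 * (n * |(k : ℝ)|) := by
  obtain ⟨h1, h2⟩ := abs_add_mul_bounds hp hk
  have hk1 : 1 ≤ |(k : ℝ)| := by exact_mod_cast Int.one_le_abs hk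
  have hn1 : (1 : ℝ) ≤ n := by exact_mod_cast hn
  have h3 : 1 ≤ n * |(k : ℝ)| := one_le_mul_of_one_le_of_one_le hn1 hk1
  refine ⟨h1.trans (abs_le_bracket _), ?_⟩
  have := bracket_le_of_abs_le (by linarith) h2
  linarith

theorem bracket_le_two_mul {n : ℕ} (hn : 0 < n) {p : ℤ} (hp : 2 * |p| ≤ n) :
    bracket p ≤ 2 * n := by
  have hp' : 2 * |(p : ℝ)| ≤ n := by exact_mod_cast hp
  exact bracket_le_of_abs_le (by exact_mod_cast hn) (by linarith [abs_nonneg (p : ℝ)])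

/-- The central estimate, for one alias: `⟨p + nk⟩` is comparable to `n|k|`, and the decay factor is
at most a constant times `⟨p⟩ / (n|k|)`. -/
theorem alias_weight_le (μ : ℕ) {s τ : ℝ} (hτ : τ ≤ μ + 1) :
    ∃ C : ℝ, 0 < C ∧ ∀ n : ℕ, 0 < n → ∀ p k : ℤ, 2 * |p| ≤ n → k ≠ 0 →
      bracket (p + n * k) ^ (2 * s) * ((|(p : ℝ)| / |((p + n * k : ℤ) : ℝ)|) ^ (μ + 1)) ^ 2 ≤
        C * (n : ℝ) ^ (2 * (s - τ)) * bracket p ^ (2 * τ) * |(k : ℝ)| ^ (2 * s - 2 * (μ + 1)) := by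
  refine ⟨((1 / 2) ^ (2 * s) + 3 ^ (2 * s)) * (2 ^ (2 * ((μ : ℝ) + 1)) *
    2 ^ (2 * ((μ : ℝ) + 1) - 2 * τ)), by positivity, fun n hn p k hp hk => ?_⟩
  have hn0 : (0 : ℝ) < n := by exact_mod_cast hn
  have hk0 : 0 < |(k : ℝ)| := by
    rw [abs_pos]
    exact_mod_cast hk
  obtain ⟨h1, h2⟩ := bracket_add_mul_bounds hn hp hk
  have h3 := (abs_add_mul_bounds hp hk).1
  have hb := bracket_pos p
  have hN : 0 < n * |(k : ℝ)| := mul_pos hn0 hk0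
  have hA := rpow_le_of_mem_Icc (2 * s) (by norm_num) (by norm_num) hN h1 h2
  have hB : ((|(p : ℝ)| / |((p + n * k : ℤ) : ℝ)|) ^ (μ + 1)) ^ 2 ≤
      2 ^ (2 * ((μ : ℝ) + 1)) * (bracket p / n) ^ (2 * ((μ : ℝ) + 1)) *
        |(k : ℝ)| ^ (-(2 * ((μ : ℝ) + 1))) := by
    have h5 : |(p : ℝ)| / |((p + n * k : ℤ) : ℝ)| ≤ 2 * (bracket p / n) * |(k : ℝ)|⁻¹ := by
      calc _ ≤ bracket p / ((1 / 2) * (n * |(k : ℝ)|)) := by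
            gcongr
            exact abs_le_bracket p
        _ = _ := by field_simp
    have h6 : (((μ + 1) * 2 : ℕ) : ℝ) = 2 * ((μ : ℝ) + 1) := by push_cast; ring
    calc _ ≤ ((2 * (bracket p / n) * |(k : ℝ)|⁻¹) ^ (μ + 1)) ^ 2 := by gcongr
      _ = (2 * (bracket p / n) * |(k : ℝ)|⁻¹) ^ (2 * ((μ : ℝ) + 1)) := by
        rw [← pow_mul, ← h6, Real.rpow_natCast]
      _ = _ := by
        rw [Real.mul_rpow (by positivity) (by positivity),
          Real.mul_rpow (by positivity) (by positivity), Real.inv_rpow hk0.le, Real.rpow_neg hk0.le]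
  -- Since `⟨p⟩ / n ≤ 2`, the exponent `2(μ + 1)` may be lowered to `2τ` at the cost of a constant;
  -- this is where `τ ≤ μ + 1` enters.
  have hD : (bracket p / n) ^ (2 * ((μ : ℝ) + 1)) ≤
      2 ^ (2 * ((μ : ℝ) + 1) - 2 * τ) * (bracket p / n) ^ (2 * τ) := by
    have h7 : bracket p / n ≤ 2 := by
      rw [div_le_iff₀ hn0]
      exact bracket_le_two_mul hn hp
    have h8 : 0 < bracket p / n := by positivity
    calc _ = (bracket p / n) ^ (2 * ((μ : ℝ) + 1) - 2 * τ) * (bracket p / n) ^ (2 * τ) := by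
          rw [← Real.rpow_add h8]; congr 1; ring
      _ ≤ _ := by
          gcongr
          linarith
  calc _ ≤ (((1 / 2) ^ (2 * s) + 3 ^ (2 * s)) * (n * |(k : ℝ)|) ^ (2 * s)) *
        (2 ^ (2 * ((μ : ℝ) + 1)) * (2 ^ (2 * ((μ : ℝ) + 1) - 2 * τ) *
          (bracket p / n) ^ (2 * τ)) * |(k : ℝ)| ^ (-(2 * ((μ : ℝ) + 1)))) := by
        refine mul_le_mul hA (hB.trans ?_) (by positivity) (by positivity)
        gcongr
    _ = _ := by
        have e1 : (n : ℝ) ^ (2 * (s - τ)) = n ^ (2 * s) / n ^ (2 * τ) := by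
          rw [← Real.rpow_sub hn0]; congr 1; ring
        have e2 : |(k : ℝ)| ^ (2 * s - 2 * ((μ : ℝ) + 1)) =
            |(k : ℝ)| ^ (2 * s) * |(k : ℝ)| ^ (-(2 * ((μ : ℝ) + 1))) := by
          rw [← Real.rpow_add hk0]; congr 1
        rw [Real.mul_rpow hn0.le hk0.le, Real.div_rpow hb.le hn0.le, e1, e2]
        ring

/-! ### Splitting the Sobolev norm into low frequencies and their aliases -/

/-- The weighted term `⟨m⟩^{2s} |c_m|²`. -/
noncomputable def weighted (s : ℝ) (c : ℤ → ℂ) (m : ℤ) : ENNReal :=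
  ENNReal.ofReal (bracket m ^ (2 * s) * ‖c m‖ ^ 2)

/-- The square of the Sobolev norm of a distribution with Fourier coefficients `c`. -/
noncomputable def energy (s : ℝ) (c : ℤ → ℂ) : ENNReal := ∑' m : ℤ, weighted s c m

theorem sobolevNorm_eq (s : ℝ) (T : Distribution) :
    sobolevNorm s T = energy s (coeff T) ^ (1 / 2 : ℝ) := rfl

/-- Representatives of the residues modulo `n` of least absolute value. -/
def balanced (n : ℕ) (j : Fin n) : ℤ := (j : ℤ) - n / 2

theorem two_mul_abs_balanced_le (n : ℕ) (j : Fin n) : 2 * |balanced n j| ≤ n := by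
  have := j.2
  rw [balanced]
  rcases abs_cases ((j : ℤ) - n / 2) with h | h <;> omega

/-- The contribution of the balanced residues to the square of the Sobolev norm. -/
noncomputable def lowEnergy (n : ℕ) (s : ℝ) (c : ℤ → ℂ) : ENNReal := ∑ j : Fin n, weighted s c (balanced n j)

/-- The contribution of the frequencies that are not balanced residues modulo `n`. -/
noncomputable def aliasEnergy (n : ℕ) (s : ℝ) (c : ℤ → ℂ) : ENNReal :=
  ∑ j : Fin n, ∑' k : ℤ, if k = 0 then 0 else weighted s c (balanced n j + n * k)

theorem energy_eq {n : ℕ} (hn : 0 < n) (s : ℝ) (c : ℤ → ℂ) :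
    energy s c = lowEnergy n s c + aliasEnergy n s c := by
  have : NeZero n := ⟨hn.ne'⟩
  -- Division with remainder, shifted by `n / 2`, writes every integer uniquely as `balanced n j + n
  -- * k`.
  have h := ((Int.divModEquiv n).symm.trans (Equiv.subRight ((n : ℤ) / 2))).tsum_eq (weighted s c)
  rw [energy, ← h, ENNReal.tsum_prod', ENNReal.tsum_comm, tsum_fintype, lowEnergy, aliasEnergy,
    ← Finset.sum_add_distrib]
  refine Finset.sum_congr rfl fun j _ => ?_
  have h2 (k : ℤ) : ((Int.divModEquiv n).symm.trans (Equiv.subRight ((n : ℤ) / 2))) (k, j) =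
      balanced n j + n * k := by
    simp only [Int.divModEquiv, Equiv.trans_apply, Equiv.coe_fn_symm_mk, Equiv.subRight_apply,
      balanced]
    ring
  simp only [h2]
  rw [ENNReal.tsum_eq_add_tsum_ite (0 : ℤ), mul_zero, add_zero]
  refine congrArg _ (tsum_congr fun k => ?_)
  split_ifs <;> rfl

theorem lowEnergy_lt_top (n : ℕ) (s : ℝ) (c : ℤ → ℂ) : lowEnergy n s c < ⊤ :=
  ENNReal.sum_lt_top.2 fun _ _ => ENNReal.ofReal_lt_top

theorem energy_mono {a s : ℝ} (has : a ≤ s) (c : ℤ → ℂ) : energy a c ≤ energy s c := by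
  refine ENNReal.tsum_le_tsum fun m => ENNReal.ofReal_le_ofReal ?_
  gcongr
  exact one_le_bracket m

theorem lowEnergy_le {a s : ℝ} (has : a ≤ s) :
    ∃ C : ℝ, 0 < C ∧ ∀ n : ℕ, 0 < n → ∀ c : ℤ → ℂ,
      lowEnergy n s c ≤ ENNReal.ofReal (C * (n : ℝ) ^ (2 * (s - a))) * lowEnergy n a c := by
  refine ⟨2 ^ (2 * (s - a)), by positivity, fun n hn c => ?_⟩
  rw [lowEnergy, lowEnergy, Finset.mul_sum]
  refine Finset.sum_le_sum fun j _ => ?_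
  rw [weighted, weighted, ← ENNReal.ofReal_mul (by positivity)]
  refine ENNReal.ofReal_le_ofReal ?_
  set p := balanced n j
  have hb := bracket_pos p
  rw [← mul_assoc]
  gcongr
  calc bracket p ^ (2 * s) = bracket p ^ (2 * (s - a)) * bracket p ^ (2 * a) := by
        rw [← Real.rpow_add hb]; congr 1; ring
    _ ≤ (2 * n) ^ (2 * (s - a)) * bracket p ^ (2 * a) := by
        gcongr
        exact bracket_le_two_mul hn (two_mul_abs_balanced_le n j)
    _ = _ := by rw [Real.mul_rpow (by norm_num) (by positivity)]

/-- Every alias satisfies `⟨m⟩ ≥ n / 2`, so lowering the order from `s` to `a` gains `n^{2(a-s)}`.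
-/
theorem aliasEnergy_le {a s : ℝ} (has : a ≤ s) :
    ∃ C : ℝ, 0 < C ∧ ∀ n : ℕ, 0 < n → ∀ c : ℤ → ℂ,
      aliasEnergy n a c ≤ ENNReal.ofReal (C * (n : ℝ) ^ (2 * (a - s))) * aliasEnergy n s c := by
  refine ⟨(1 / 2) ^ (2 * (a - s)), by positivity, fun n hn c => ?_⟩
  rw [aliasEnergy, aliasEnergy, Finset.mul_sum]
  refine Finset.sum_le_sum fun j _ => ?_
  rw [← ENNReal.tsum_mul_left]
  refine ENNReal.tsum_le_tsum fun k => ?_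
  split_ifs with hk
  · simp
  rw [weighted, weighted, ← ENNReal.ofReal_mul (by positivity)]
  refine ENNReal.ofReal_le_ofReal ?_
  have h1 := (bracket_add_mul_bounds hn (two_mul_abs_balanced_le n j) hk).1
  set m := balanced n j + n * k
  have hb := bracket_pos m
  have hn0 : (0 : ℝ) < n := by exact_mod_cast hn
  have hk1 : 1 ≤ |(k : ℝ)| := by exact_mod_cast Int.one_le_abs hk
  have h2 : (1 / 2) * (n : ℝ) ≤ bracket m := by nlinarith
  rw [← mul_assoc]
  gcongr
  calc bracket m ^ (2 * a) = bracket m ^ (2 * (a - s)) * bracket m ^ (2 * s) := by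
        rw [← Real.rpow_add hb]; congr 1; ring
    _ ≤ (1 / 2 * n) ^ (2 * (a - s)) * bracket m ^ (2 * s) := by
        have h3 := Real.rpow_le_rpow_of_nonpos (z := 2 * (a - s)) (by positivity) h2 (by linarith)
        gcongr
    _ = _ := by rw [Real.mul_rpow (by norm_num) (by positivity)]

theorem aliasEnergy_sub_le (n : ℕ) (s : ℝ) (c d : ℤ → ℂ) :
    aliasEnergy n s (fun m => c m - d m) ≤ 2 * aliasEnergy n s c + 2 * aliasEnergy n s d := by
  rw [aliasEnergy, aliasEnergy, aliasEnergy, Finset.mul_sum, Finset.mul_sum,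
    ← Finset.sum_add_distrib]
  refine Finset.sum_le_sum fun j _ => ?_
  rw [← ENNReal.tsum_mul_left, ← ENNReal.tsum_mul_left, ← ENNReal.tsum_add]
  refine ENNReal.tsum_le_tsum fun k => ?_
  split_ifs with hk
  · simp
  set m := balanced n j + n * k
  have hb := Real.rpow_nonneg (bracket_pos m).le (2 * s)
  rw [weighted, weighted, weighted, ← mul_add, ← ENNReal.ofReal_add (by positivity) (by positivity),
    ← ENNReal.ofReal_ofNat 2, ← ENNReal.ofReal_mul (by norm_num)]
  refine ENNReal.ofReal_le_ofReal ?_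
  have h1 : ‖c m - d m‖ ^ 2 ≤ 2 * (‖c m‖ ^ 2 + ‖d m‖ ^ 2) := by
    have := norm_sub_le (c m) (d m)
    nlinarith [norm_nonneg (c m - d m), sq_nonneg (‖c m‖ - ‖d m‖)]
  calc _ ≤ bracket m ^ (2 * s) * (2 * (‖c m‖ ^ 2 + ‖d m‖ ^ 2)) := by gcongr
    _ = _ := by ring

/-! ### Sequences with the aliasing property of splines -/

/-- The moduli of the aliases of `c p` decay like those of the Fourier coefficients of a spline of
degree `μ`. -/
def HasSplineAliasing (n μ : ℕ) (c : ℤ → ℂ) : Prop :=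
  ∀ p k : ℤ, 2 * |p| ≤ n → k ≠ 0 →
    ‖c (p + n * k)‖ = ‖c p‖ * (|(p : ℝ)| / |((p + n * k : ℤ) : ℝ)|) ^ (μ + 1)

theorem tsum_abs_rpow_ne_top {r : ℝ} (hr : r < -1) :
    ∑' k : ℤ, ENNReal.ofReal (|(k : ℝ)| ^ r) ≠ ⊤ := by
  have h := Real.summable_abs_int_rpow (b := -r) (by linarith)
  rw [neg_neg] at h
  exact h.tsum_ofReal_ne_top

theorem HasSplineAliasing.aliasEnergy_le (μ : ℕ) {s τ : ℝ} (hs : s < μ + 1 / 2)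
    (hτ : τ ≤ μ + 1) :
    ∃ C : ℝ, 0 < C ∧ ∀ n : ℕ, 0 < n → ∀ c : ℤ → ℂ, HasSplineAliasing n μ c →
      aliasEnergy n s c ≤ ENNReal.ofReal (C * (n : ℝ) ^ (2 * (s - τ))) * lowEnergy n τ c := by
  obtain ⟨C, hC, h⟩ := alias_weight_le μ (s := s) hτ
  set r : ℝ := 2 * s - 2 * (μ + 1) with hr
  -- The condition `s < μ + 1/2` says precisely that `r < -1`.
  have hS := tsum_abs_rpow_ne_top (r := r) (by linarith)
  set S := (∑' k : ℤ, ENNReal.ofReal (|(k : ℝ)| ^ r)).toReal with hSdef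
  -- `S + 1` makes the constant visibly positive.
  refine ⟨C * (S + 1), by positivity, fun n hn c hc => ?_⟩
  rw [aliasEnergy, lowEnergy, Finset.mul_sum]
  refine Finset.sum_le_sum fun j _ => ?_
  set p := balanced n j with hp
  have hb := bracket_pos p
  calc ∑' k : ℤ, (if k = 0 then 0 else weighted s c (p + n * k))
      ≤ ∑' k : ℤ, ENNReal.ofReal (C * (n : ℝ) ^ (2 * (s - τ)) * bracket p ^ (2 * τ) *
          ‖c p‖ ^ 2) * ENNReal.ofReal (|(k : ℝ)| ^ r) := by
        refine ENNReal.tsum_le_tsum fun k => ?_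
        split_ifs with hk
        · exact zero_le
        rw [weighted, ← ENNReal.ofReal_mul (by positivity)]
        refine ENNReal.ofReal_le_ofReal ?_
        rw [hc p k (two_mul_abs_balanced_le n j) hk]
        have h1 := mul_le_mul_of_nonneg_right (h n hn p k (two_mul_abs_balanced_le n j) hk)
          (sq_nonneg ‖c p‖)
        calc _ = _ := by rw [mul_pow]; ring
          _ ≤ _ := h1
          _ = _ := by ring
    _ = ENNReal.ofReal (C * (n : ℝ) ^ (2 * (s - τ)) * bracket p ^ (2 * τ) * ‖c p‖ ^ 2) *
          ENNReal.ofReal S := by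
        rw [ENNReal.tsum_mul_left, hSdef, ENNReal.ofReal_toReal hS]
    _ ≤ _ := by
        have hS0 : 0 ≤ S := ENNReal.toReal_nonneg
        rw [weighted, ← ENNReal.ofReal_mul (by positivity), ← ENNReal.ofReal_mul (by positivity)]
        refine ENNReal.ofReal_le_ofReal ?_
        calc _ ≤ (C * (n : ℝ) ^ (2 * (s - τ)) * bracket p ^ (2 * τ) * ‖c p‖ ^ 2) * (S + 1) := by
              gcongr
              linarith
          _ = _ := by ring

/-- The right side is a finite sum, so the bound also proves that the left side is finite. -/
theorem HasSplineAliasing.energy_le_lowEnergy (μ : ℕ) {a s : ℝ} (has : a ≤ s)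
    (hs : s < μ + 1 / 2) :
    ∃ C : ℝ, 0 < C ∧ ∀ n : ℕ, 0 < n → ∀ c : ℤ → ℂ, HasSplineAliasing n μ c →
      energy s c ≤ ENNReal.ofReal (C * (n : ℝ) ^ (2 * (s - a))) * lowEnergy n a c := by
  obtain ⟨C₁, h1, H1⟩ := lowEnergy_le has
  obtain ⟨C₂, h2, H2⟩ := HasSplineAliasing.aliasEnergy_le μ (τ := a) hs (by linarith)
  refine ⟨C₁ + C₂, by positivity, fun n hn c hc => ?_⟩
  rw [energy_eq hn, add_mul, ENNReal.ofReal_add (by positivity) (by positivity), add_mul]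
  exact add_le_add (H1 n hn c) (H2 n hn c hc)

theorem HasSplineAliasing.energy_sub_le (μ : ℕ) {a s : ℝ} (has : a ≤ s) (hs : s ≤ μ + 1)
    (ha : a < μ + 1 / 2) :
    ∃ C : ℝ, 0 < C ∧ ∀ n : ℕ, 0 < n → ∀ c d : ℤ → ℂ, HasSplineAliasing n μ d →
      (∀ j, d (balanced n j) = c (balanced n j)) →
      energy a (fun m => c m - d m) ≤
        ENNReal.ofReal (C * (n : ℝ) ^ (2 * (a - s))) * energy s c := by
  obtain ⟨C₁, h1, H1⟩ := PeriodicSpline.aliasEnergy_le has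
  -- Here the decay estimate is used at order `a` with `τ = s`, so `s` itself may reach `μ + 1`.
  obtain ⟨C₂, h2, H2⟩ := HasSplineAliasing.aliasEnergy_le μ ha hs
  refine ⟨2 * (C₁ + C₂), by positivity, fun n hn c d hd hcd => ?_⟩
  have hlow : lowEnergy n a (fun m => c m - d m) = 0 :=
    Finset.sum_eq_zero fun j _ => by simp [weighted, hcd]
  have hlow' : lowEnergy n s d = lowEnergy n s c :=
    Finset.sum_congr rfl fun j _ => by simp only [weighted, hcd]
  have h3 : aliasEnergy n s c ≤ energy s c := energy_eq hn s c ▸ le_add_self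
  have h4 : lowEnergy n s c ≤ energy s c := energy_eq hn s c ▸ le_self_add
  rw [energy_eq hn a, hlow, zero_add]
  calc _ ≤ 2 * aliasEnergy n a c + 2 * aliasEnergy n a d := aliasEnergy_sub_le n a c d
    _ ≤ 2 * (ENNReal.ofReal (C₁ * (n : ℝ) ^ (2 * (a - s))) * energy s c) +
        2 * (ENNReal.ofReal (C₂ * (n : ℝ) ^ (2 * (a - s))) * energy s c) := by
      gcongr
      · exact (H1 n hn c).trans (by gcongr)
      · exact (H2 n hn d hd).trans (by rw [hlow']; gcongr)
    _ = _ := by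
      rw [mul_assoc 2, ENNReal.ofReal_mul (p := 2) (by norm_num), add_mul,
        ENNReal.ofReal_add (by positivity) (by positivity), ENNReal.ofReal_ofNat]
      ring

/-! ### Fourier coefficients of elements of the spline space -/

theorem intervalIntegrable_mul_monomialFun {f : ℝ → ℂ} (hf : f ∈ PeriodicIntegrable) (m : ℤ) :
    IntervalIntegrable (fun x => f x * monomialFun m x) volume 0 1 :=
  intervalIntegrable_mul ⟨f, hf⟩ (monomial m)

theorem splineCoeff_eq_mul_monomialFun (n μ l : ℕ) (m : ℤ) :
    splineCoeff n μ l m = ((Real.sinc (π * mesh n * m) ^ (μ + 1) : ℝ) : ℂ) *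
      (mesh n * monomialFun (-m) (((l : ℝ) - 1) * mesh n)) := by
  rw [splineCoeff, monomialFun, Complex.ofReal_mul, mul_comm (mesh n : ℂ), mul_assoc]
  congr 3
  push_cast
  ring

theorem monomialFun_add_mul {n : ℕ} (hn : 0 < n) (m k j : ℤ) :
    monomialFun (m + n * k) (j * mesh n) = monomialFun m (j * mesh n) := by
  have hn0 : (n : ℂ) ≠ 0 := by exact_mod_cast hn.ne'
  rw [monomialFun, monomialFun, Complex.exp_eq_exp_iff_exists_int]
  refine ⟨k * j, ?_⟩
  rw [mesh]
  push_cast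
  field_simp

/-- The `sinc` factor is common to all generators, and each phase is periodic modulo `n` because the
nodes are integer multiples of `1 / n`; both features survive linear combinations. -/
theorem exists_periodic_factor {n μ : ℕ} (hn : 0 < n) {f : ℝ → ℂ} (hf : f ∈ splineSpace n μ) :
    ∃ A : ℤ → ℂ, (∀ m k : ℤ, A (m + n * k) = A m) ∧ ∀ m : ℤ,
      ∫ x in (0 : ℝ)..1, f x * monomialFun (-m) x =
        ((Real.sinc (π * mesh n * m) ^ (μ + 1) : ℝ) : ℂ) * A m := by
  induction hf using Submodule.span_induction with
  | mem f hf =>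
    obtain ⟨l, _, rfl⟩ := hf
    refine ⟨fun m => mesh n * monomialFun (-m) (((l : ℝ) - 1) * mesh n), fun m k => ?_, fun m => ?_⟩
    · have h := monomialFun_add_mul hn (-m) (-k) ((l : ℤ) - 1)
      push_cast at h
      dsimp only
      rw [neg_add, ← mul_neg, h]
    · rw [integral_splineC_mul_monomialFun hn, splineCoeff_eq_mul_monomialFun]
  | zero => exact ⟨0, by simp, by simp⟩
  | add f g hf hg ihf ihg =>
    obtain ⟨A, hA, hA'⟩ := ihf
    obtain ⟨B, hB, hB'⟩ := ihg
    refine ⟨A + B, fun m k => by simp [hA, hB], fun m => ?_⟩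
    simp only [Pi.add_apply, add_mul, mul_add]
    rw [intervalIntegral.integral_add
      (intervalIntegrable_mul_monomialFun (splineSpace_le n μ hf) _)
      (intervalIntegrable_mul_monomialFun (splineSpace_le n μ hg) _), hA', hB']
  | smul a f hf ihf =>
    obtain ⟨A, hA, hA'⟩ := ihf
    refine ⟨a • A, fun m k => by simp [hA], fun m => ?_⟩
    simp only [Pi.smul_apply, smul_eq_mul, mul_assoc]
    rw [intervalIntegral.integral_const_mul, hA']
    ring_nf

/-- Passing to an alias shifts the argument of the sine by `kπ`, which changes only its sign; the
denominators account for the ratio. For `p = 0` both sides vanish. -/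
theorem abs_sinc_add_mul {n : ℕ} (hn : 0 < n) {p k : ℤ} (hp : 2 * |p| ≤ n) (hk : k ≠ 0) :
    |Real.sinc (π * mesh n * (p + n * k : ℤ))| =
      |Real.sinc (π * mesh n * p)| * (|(p : ℝ)| / |((p + n * k : ℤ) : ℝ)|) := by
  have hh := mesh_pos hn
  have hc : 0 < π * mesh n := mul_pos Real.pi_pos hh
  have hm : 0 < |((p + n * k : ℤ) : ℝ)| := by
    refine lt_of_lt_of_le ?_ (abs_add_mul_bounds hp hk).1
    have : 0 < |(k : ℝ)| := by rw [abs_pos]; exact_mod_cast hk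
    positivity
  have h1 : Real.sin (π * mesh n * (p + n * k : ℤ)) = (-1) ^ k * Real.sin (π * mesh n * p) := by
    rw [← Real.sin_add_int_mul_pi]
    congr 1
    push_cast
    linear_combination (π * k) * natCast_mul_mesh hn
  have h2 : |Real.sin (π * mesh n * (p + n * k : ℤ))| = |Real.sin (π * mesh n * p)| := by
    rw [h1, abs_mul, abs_zpow, abs_neg, abs_one, one_zpow, one_mul]
  have h3 (x : ℝ) : |Real.sin x| = |Real.sinc x| * |x| := by
    rcases eq_or_ne x 0 with rfl | hx
    · simp
    · rw [Real.sinc_of_ne_zero hx, ← abs_mul, div_mul_cancel₀ _ hx]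
  rw [h3, h3, abs_mul _ ((p + n * k : ℤ) : ℝ), abs_mul _ (p : ℝ), abs_of_pos hc] at h2
  rw [mul_div_assoc', eq_div_iff hm.ne']
  exact mul_left_cancel₀ hc.ne' (by linear_combination h2)

theorem coeff_splineSpaceDist {n μ : ℕ} (v : splineSpace n μ) (m : ℤ) :
    coeff (splineSpaceDist v) m = ∫ x in (0 : ℝ)..1, (v : ℝ → ℂ) x * monomialFun (-m) x := rfl

theorem hasSplineAliasing_coeff {n μ : ℕ} (hn : 0 < n) (v : splineSpace n μ) :
    HasSplineAliasing n μ (coeff (splineSpaceDist v)) := by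
  obtain ⟨A, hA, hA'⟩ := exists_periodic_factor hn v.2
  intro p k hp hk
  rw [coeff_splineSpaceDist, coeff_splineSpaceDist, hA', hA', hA, norm_mul, norm_mul,
    Complex.norm_real, Complex.norm_real, norm_pow, norm_pow, Real.norm_eq_abs, Real.norm_eq_abs,
    abs_sinc_add_mul hn hp hk, mul_pow]
  ring

/-- The argument lies strictly between `-π` and `π`, where the sine vanishes only at zero. -/
theorem sinc_balanced_ne_zero {n : ℕ} (hn : 0 < n) {p : ℤ} (hp : 2 * |p| ≤ n) :
    Real.sinc (π * mesh n * p) ≠ 0 := by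
  rcases eq_or_ne p 0 with rfl | h0
  · simp
  have hh := mesh_pos hn
  have hπ := Real.pi_pos
  have hx : π * mesh n * p ≠ 0 :=
    mul_ne_zero (mul_pos hπ hh).ne' (by exact_mod_cast h0)
  have hp' : 2 * |(p : ℝ)| ≤ n := by exact_mod_cast hp
  have h1 : |mesh n * p| < 1 := by
    rw [abs_mul, abs_of_pos hh]
    nlinarith [natCast_mul_mesh hn]
  rw [abs_lt] at h1
  rw [Real.sinc_of_ne_zero hx]
  refine div_ne_zero ?_ hx
  rw [Ne, Real.sin_eq_zero_iff_of_lt_of_lt (by nlinarith) (by nlinarith)]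
  exact hx

/-- Orthogonality of the discrete characters of `ℤ / n`. -/
theorem mesh_mul_sum_monomialFun {n : ℕ} (hn : 0 < n) (i j : Fin n) :
    (mesh n : ℂ) * ∑ l ∈ Finset.range n, monomialFun (balanced n j - balanced n i) (l * mesh n) =
      if j = i then 1 else 0 := by
  have hn0 : (n : ℂ) ≠ 0 := by exact_mod_cast hn.ne'
  have hz (l : ℕ) : monomialFun (balanced n j - balanced n i) (l * mesh n) =
      monomialFun (balanced n j - balanced n i) (mesh n) ^ l := by
    rw [monomialFun, monomialFun, ← Complex.exp_nat_mul]
    congr 1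
    push_cast
    ring
  simp only [hz]
  split_ifs with h
  · subst h
    simp [monomialFun, mesh, hn0]
  · have hne : monomialFun (balanced n j - balanced n i) (mesh n) ≠ 1 := by
      intro h1
      rw [monomialFun, Complex.exp_eq_one_iff] at h1
      obtain ⟨k, hk⟩ := h1
      have h2 : (2 * (π : ℂ) * Complex.I) ≠ 0 := Complex.two_pi_I_ne_zero
      have h3 : ((balanced n j - balanced n i : ℤ) : ℂ) = k * n := by
        refine mul_left_cancel₀ h2 ?_
        rw [mesh] at hk
        push_cast at hk ⊢
        field_simp at hk
        linear_combination (2 * (π : ℂ) * Complex.I) * hk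
      have h4 : balanced n j - balanced n i = k * n := by exact_mod_cast h3
      have h5 : (j : ℤ) - i = k * n := by rw [← h4, balanced, balanced]; ring
      have h6 := Int.eq_zero_of_abs_lt_dvd (m := n) (x := (j : ℤ) - i) ⟨k, by rw [h5, mul_comm]⟩
        (by rw [abs_lt]; constructor <;> omega)
      exact h (Fin.ext (by omega))
    have hpow : monomialFun (balanced n j - balanced n i) (mesh n) ^ n = 1 := by
      rw [← hz, natCast_mul_mesh hn]
      have := (monomialFun_periodic (balanced n j - balanced n i)) 0
      rw [zero_add] at this
      rw [this]
      simp [monomialFun]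
    rw [geom_sum_eq hne, hpow, sub_self, zero_div, mul_zero]

theorem exists_spline_interpolating {n : ℕ} (hn : 0 < n) (μ : ℕ) (c : ℤ → ℂ) :
    ∃ v : splineSpace n μ, ∀ i : Fin n,
      coeff (splineSpaceDist v) (balanced n i) = c (balanced n i) := by
  set σ : Fin n → ℂ := fun j => ((Real.sinc (π * mesh n * balanced n j) ^ (μ + 1) : ℝ) : ℂ)
    with hσ
  have hσ0 (j : Fin n) : σ j ≠ 0 := by
    rw [hσ, Complex.ofReal_ne_zero]
    exact pow_ne_zero _ (sinc_balanced_ne_zero hn (two_mul_abs_balanced_le n j))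
  -- The inverse discrete Fourier transform of the target coefficients divided by the `sinc`
  -- factors; `α l` multiplies the spline of index `l + 1`, whose node is `l * mesh n`.
  set α : ℕ → ℂ := fun l =>
    ∑ j : Fin n, c (balanced n j) / σ j * monomialFun (balanced n j) (l * mesh n) with hα
  refine ⟨⟨∑ l ∈ Finset.range n, α l • splineC n μ (l + 1), Submodule.sum_mem _ fun l hl =>
    Submodule.smul_mem _ _ (Submodule.subset_span ⟨l + 1, ?_, rfl⟩)⟩, fun i => ?_⟩
  · rw [Finset.mem_range] at hl
    exact ⟨by omega, by omega⟩
  · have h1 (l : ℕ) : IntervalIntegrable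
        (fun x => α l * splineC n μ (l + 1) x * monomialFun (-balanced n i) x) volume 0 1 := by
      simp only [mul_assoc]
      exact (intervalIntegrable_mul_monomialFun (splineC_mem n μ (l + 1)) _).const_mul _
    have h2 (l : ℕ) : ∫ x in (0 : ℝ)..1,
        α l * splineC n μ (l + 1) x * monomialFun (-balanced n i) x =
          σ i * mesh n * (α l * monomialFun (-balanced n i) (l * mesh n)) := by
      simp only [mul_assoc]
      rw [intervalIntegral.integral_const_mul, integral_splineC_mul_monomialFun hn,
        splineCoeff_eq_mul_monomialFun, Nat.cast_succ, add_sub_cancel_right]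
      ring
    have h3 (l : ℕ) : α l * monomialFun (-balanced n i) (l * mesh n) =
        ∑ j : Fin n, c (balanced n j) / σ j *
          monomialFun (balanced n j - balanced n i) (l * mesh n) := by
      rw [hα, Finset.sum_mul]
      refine Finset.sum_congr rfl fun j _ => ?_
      rw [mul_assoc, monomialFun, monomialFun, monomialFun, ← Complex.exp_add]
      congr 2
      push_cast
      ring
    rw [coeff_splineSpaceDist]
    simp only [Finset.sum_apply, Pi.smul_apply, smul_eq_mul, Finset.sum_mul]
    rw [intervalIntegral.integral_finsetSum fun l _ => h1 l]
    simp only [h2, h3]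
    rw [← Finset.mul_sum, Finset.sum_comm]
    simp only [← Finset.mul_sum]
    rw [mul_assoc, Finset.mul_sum]
    simp only [mul_left_comm (mesh n : ℂ), mesh_mul_sum_monomialFun hn]
    simp [mul_div_cancel₀, hσ0]

/-! ### Regularity, approximation and inverse inequality -/

theorem splineSpaceDist_mem_sobolevSpace {n μ : ℕ} (hn : 0 < n) (v : splineSpace n μ) {a : ℝ}
    (ha : a < μ + 1 / 2) : splineSpaceDist v ∈ sobolevSpace a := by
  -- Equal orders: the norm is controlled by finitely many coefficients.
  obtain ⟨C, _, h⟩ := HasSplineAliasing.energy_le_lowEnergy μ le_rfl ha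
  refine ENNReal.rpow_lt_top_of_nonneg (by norm_num) (ne_of_lt ?_)
  exact (h n hn _ (hasSplineAliasing_coeff hn v)).trans_lt
    (ENNReal.mul_lt_top ENNReal.ofReal_lt_top (lowEnergy_lt_top _ _ _))

theorem splineDist_mem_sobolevSpace {n : ℕ} (hn : 0 < n) (μ : ℕ) {l : ℕ}
    (hl : l ∈ Finset.Icc 1 n) {a : ℝ} (ha : a < μ + 1 / 2) :
    splineDist n μ l ∈ sobolevSpace a :=
  splineSpaceDist_mem_sobolevSpace hn
    ⟨splineC n μ l, Submodule.subset_span ⟨l, Finset.mem_Icc.1 hl, rfl⟩⟩ ha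

theorem rpow_half_le {C t : ℝ} {n : ℕ} {E F : ENNReal} (hC : 0 ≤ C)
    (h : E ≤ ENNReal.ofReal (C * (n : ℝ) ^ (2 * t)) * F) :
    E ^ (1 / 2 : ℝ) ≤ ENNReal.ofReal (√C * (n : ℝ) ^ t) * F ^ (1 / 2 : ℝ) := by
  have h1 := ENNReal.rpow_le_rpow h (z := 1 / 2) (by norm_num)
  rw [ENNReal.mul_rpow_of_nonneg _ _ (by norm_num),
    ENNReal.ofReal_rpow_of_nonneg (by positivity) (by norm_num),
    Real.mul_rpow hC (by positivity), ← Real.sqrt_eq_rpow, ← Real.rpow_mul (Nat.cast_nonneg n)]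
    at h1
  convert h1 using 5
  ring

theorem mesh_rpow (n : ℕ) (t : ℝ) : mesh n ^ t = (n : ℝ) ^ (-t) := by
  rw [mesh, one_div, Real.inv_rpow (Nat.cast_nonneg n), Real.rpow_neg (Nat.cast_nonneg n)]

theorem sobolevNorm_mono {a s : ℝ} (has : a ≤ s) (T : Distribution) :
    sobolevNorm a T ≤ sobolevNorm s T := by
  rw [sobolevNorm_eq, sobolevNorm_eq]
  exact ENNReal.rpow_le_rpow (energy_mono has _) (by norm_num)

theorem iInf_sobolevNorm_sub_le (μ : ℕ) {a s : ℝ} (has : a ≤ s) (hs : s ≤ μ + 1)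
    (ha : a < μ + 1 / 2) :
    ∃ C : ℝ, 0 < C ∧ ∀ n : ℕ, 0 < n → ∀ u : Distribution,
      ⨅ v : splineSpace n μ, sobolevNorm a (u - splineSpaceDist v) ≤
        ENNReal.ofReal (C * mesh n ^ (s - a)) * sobolevNorm s u := by
  obtain ⟨C, hC, h⟩ := HasSplineAliasing.energy_sub_le μ has hs ha
  refine ⟨√C, Real.sqrt_pos.2 hC, fun n hn u => ?_⟩
  -- The competitor in the infimum shares the coefficients of `u` at all balanced residues.
  obtain ⟨v, hv⟩ := exists_spline_interpolating hn μ (coeff u)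
  refine (iInf_le _ v).trans ?_
  rw [mesh_rpow, neg_sub]
  exact rpow_half_le hC.le (h n hn _ _ (hasSplineAliasing_coeff hn v) hv)

theorem inverse_inequality (μ : ℕ) {a s : ℝ} (has : a ≤ s) (hs : s < μ + 1 / 2) :
    ∃ C : ℝ, 0 < C ∧ ∀ n : ℕ, 0 < n → ∀ v : splineSpace n μ,
      ENNReal.ofReal (C * mesh n ^ (s - a)) * sobolevNorm s (splineSpaceDist v) ≤
        sobolevNorm a (splineSpaceDist v) := by
  obtain ⟨C, hC, h⟩ := HasSplineAliasing.energy_le_lowEnergy μ has hs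
  have hC' := Real.sqrt_pos.2 hC
  refine ⟨(√C)⁻¹, inv_pos.2 hC', fun n hn v => ?_⟩
  have hn0 : (0 : ℝ) < n := by exact_mod_cast hn
  have h1 : energy s (coeff (splineSpaceDist v)) ≤
      ENNReal.ofReal (C * (n : ℝ) ^ (2 * (s - a))) * energy a (coeff (splineSpaceDist v)) :=
    (h n hn _ (hasSplineAliasing_coeff hn v)).trans
      (by gcongr; exact energy_eq hn a _ ▸ le_self_add)
  have h2 := rpow_half_le hC.le h1
  rw [← sobolevNorm_eq, ← sobolevNorm_eq] at h2
  calc _ ≤ ENNReal.ofReal ((√C)⁻¹ * mesh n ^ (s - a)) *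
        (ENNReal.ofReal (√C * (n : ℝ) ^ (s - a)) * sobolevNorm a (splineSpaceDist v)) := by gcongr
    _ = _ := by
      rw [← mul_assoc, ← ENNReal.ofReal_mul (by have := mesh_pos hn; positivity), mesh_rpow,
        Real.rpow_neg hn0.le]
      have h3 : (√C)⁻¹ * ((n : ℝ) ^ (s - a))⁻¹ * (√C * (n : ℝ) ^ (s - a)) = 1 := by
        have := Real.rpow_pos_of_pos hn0 (s - a)
        field_simp
      rw [h3, ENNReal.ofReal_one, one_mul]

end PeriodicSpline

theorem mainTheorem3 :
    -- partition of unity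
    (∀ n μ : ℕ, 0 < n → (μ = 0 ∨ μ + 1 < n) → ∀ x : ℝ,
      ∑ l ∈ Finset.Icc 1 n, PeriodicSpline.spline n μ l x = 1) ∧
    -- the first spline is even (for degree zero: away from the jump points)
    (∀ n μ : ℕ, 0 < n → (μ = 0 ∨ μ + 1 < n) → ∀ x : ℝ,
      (μ = 0 → ∀ m : ℤ, x ≠ PeriodicSpline.mesh n / 2 + m ∧ x ≠ -(PeriodicSpline.mesh n) / 2 + m) →
      PeriodicSpline.spline n μ 1 x = PeriodicSpline.spline n μ 1 (-x)) ∧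
    -- Fourier coefficients and Fourier series
    (∀ n μ : ℕ, 0 < n → (μ = 0 ∨ μ + 1 < n) → ∀ l ∈ Finset.Icc 1 n,
      (∀ m : ℤ, fourierCoeffOn (zero_lt_one' ℝ) (PeriodicSpline.splineC n μ l) m =
        PeriodicSpline.splineCoeff n μ l m) ∧
      Filter.Tendsto
        (fun S : Finset ℤ => MeasureTheory.eLpNorm
          (fun x : ℝ => PeriodicSpline.splineC n μ l x -
            ∑ m ∈ S, PeriodicSpline.splineCoeff n μ l m * PeriodicSpline.monomialFun m x)
          2 (MeasureTheory.volume.restrict (Set.Ioc (0 : ℝ) 1)))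
        Filter.atTop (nhds 0) ∧
      (1 ≤ μ → ∀ x : ℝ, HasSum
        (fun m : ℤ => PeriodicSpline.splineCoeff n μ l m * PeriodicSpline.monomialFun m x)
        (PeriodicSpline.splineC n μ l x))) ∧
    -- Sobolev regularity
    (∀ n μ : ℕ, 0 < n → (μ = 0 ∨ μ + 1 < n) → ∀ l ∈ Finset.Icc 1 n, ∀ a : ℝ,
      a < (μ : ℝ) + 1 / 2 →
      PeriodicSpline.splineDist n μ l ∈ PeriodicSpline.sobolevSpace a) ∧
    -- approximation property
    (∀ (μ : ℕ) (a s : ℝ), a ≤ s → s ≤ (μ : ℝ) + 1 → a < (μ : ℝ) + 1 / 2 →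
      ∃ c₁ : ℝ, 0 < c₁ ∧ ∀ n : ℕ, 0 < n → (μ = 0 ∨ μ + 1 < n) →
        ∀ u ∈ PeriodicSpline.sobolevSpace s,
          ⨅ v : PeriodicSpline.splineSpace n μ,
              PeriodicSpline.sobolevNorm a (u - PeriodicSpline.splineSpaceDist v) ≤
            ENNReal.ofReal (c₁ * PeriodicSpline.mesh n ^ (s - a)) *
              PeriodicSpline.sobolevNorm s u) ∧
    -- inverse inequality
    (∀ (μ : ℕ) (a s : ℝ), a ≤ s → s < (μ : ℝ) + 1 / 2 →
      ∃ c₂ : ℝ, 0 < c₂ ∧ ∀ n : ℕ, 0 < n → (μ = 0 ∨ μ + 1 < n) →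
        ∀ v : PeriodicSpline.splineSpace n μ,
          ENNReal.ofReal (c₂ * PeriodicSpline.mesh n ^ (s - a)) *
              PeriodicSpline.sobolevNorm s (PeriodicSpline.splineSpaceDist v) ≤
            PeriodicSpline.sobolevNorm a (PeriodicSpline.splineSpaceDist v) ∧
          PeriodicSpline.sobolevNorm a (PeriodicSpline.splineSpaceDist v) ≤
            PeriodicSpline.sobolevNorm s (PeriodicSpline.splineSpaceDist v)) := by
  refine ⟨fun n μ hn _ x => PeriodicSpline.sum_spline_eq_one hn μ x,
    fun n μ _ _ x hx => ?_, fun n μ hn _ l _ => ⟨PeriodicSpline.fourierCoeffOn_splineC hn μ l, ?_,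
      fun hμ => PeriodicSpline.splineC_hasSum hn hμ l⟩,
    fun n μ hn _ l hl a ha => PeriodicSpline.splineDist_mem_sobolevSpace hn μ hl ha,
    fun μ a s has hs ha => ?_, fun μ a s has hs => ?_⟩
  · rw [PeriodicSpline.spline_one, PeriodicSpline.spline_one, PeriodicSpline.firstSpline_neg hx]
  · simpa only [PeriodicSpline.fourierCoeffOn_splineC hn] using
      PeriodicSpline.tendsto_eLpNorm_fourier_series (PeriodicSpline.splineC_memLp n μ l)
  · obtain ⟨C, hC, h⟩ := PeriodicSpline.iInf_sobolevNorm_sub_le μ has hs ha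
    exact ⟨C, hC, fun n hn _ u _ => h n hn u⟩
  · obtain ⟨C, hC, h⟩ := PeriodicSpline.inverse_inequality μ has hs
    exact ⟨C, hC, fun n hn _ v => ⟨h n hn v, PeriodicSpline.sobolevNorm_mono has _⟩⟩
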